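/- **Setting.** Let $B=(V,E)$ be a Bratteli diagram with levels $V_n$ ($n\ge 0$, $V_0=\{v_0\}$), edge sets $E_n$ ($n\ge1$) from $V_{n-1}$ to $V_n$, source and range maps $s,r$, and incidence matrices $F_n$, $n\ge 1$, where $f^{(n)}_{u,w}$ is the number of edges from $w\in V_n$ to $u\in V_{n+1}$. Let $X_B$ be the space of infinite paths from $v_0$, and $v_n(x)$ the vertex of the path $x$ at level $n$. Assume that $X_B$ has no isolated points, that every tail-equivalence class in $X_B$ is infinite, and that for every order on $B$ (a linear order on each $r^{-1}(v)$) the sets of maximal and of minimal infinite paths have empty interior. A *skeleton* $\mathcal F$ on $B$ consists of closed nowhere dense sets $X_{\max}(\mathcal F),X_{\min}(\mathcal F)\subseteq X_B$ of equal cardinality, such that two paths of the same set that meet at level $N$ coincide up to level $N$, and of edges $\widetilde e_v,\overline e_v\in r^{-1}(v)$ for $v\in V_n$, $n\ge 1$, with $s(\widetilde e_v)\in\widetilde V_{n-1}$ and $s(\overline e_v)\in\overline V_{n-1}$, where $\widetilde V_n=\{v_n(M):M\in X_{\max}(\mathcal F)\}$ and $\overline V_n=\{v_n(m):m\in X_{\min}(\mathcal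 F)\}$; every $M\in X_{\max}(\mathcal F)$ uses only edges $\widetilde e_v$ and every $m\in X_{\min}(\mathcal F)$ only edges $\overline e_v$; and $\widetilde e_v\ne\overline e_v$ whenever $v\in\widetilde V_n\cap\overline V_n$, $n\ge2$, or $|r^{-1}(v)|\ge 2$. An order $\omega$ has skeleton $\mathcal F$, written $\mathcal F_\omega=\mathcal F$, if $X_{\max}(\omega)=X_{\max}(\mathcal F)$, $X_{\min}(\omega)=X_{\min}(\mathcal F)$ and, for each $v$, $\widetilde e_v$ and $\overline e_v$ are the maximal and the minimal edge of $r^{-1}(v)$. A *correspondence* associated to $\mathcal F$ is a sequence of maps $\sigma_n:\widetilde V_n\to 2^{\overline V_n}$ with $\bigcup_{\widetilde v}\sigma_n(\widetilde v)=\overline V_n$ such that: (1) if $n<N$ and $\overline v\in\sigma_N(\widetilde v)$, then the source at level $n$ of the path of edges $\overline e$ ending at $\overline v$ lies in $\sigma_n$ of the source at level $n$ of the path of edges $\widetilde e$ ending at $\widetilde v$; (2) for each $M\in X_{\max}(\mathcal F)$ there is a unique $m\in X_{\min}(\mathcal F)$, and (3) for each $m\in X_{\min}(\mathcal F)$ a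 unique $M\in X_{\max}(\mathcal F)$, with $v_n(m)\in\sigma_n(v_n(M))$ for all $n$; (4) the resulting bijection $\sigma:X_{\max}(\mathcal F)\to X_{\min}(\mathcal F)$ is a homeomorphism. The pair $(\mathcal F,\sigma)$ *can generate orders in $\mathcal P_B^*$* if for each $M\in X_{\max}(\mathcal F)$ the set $\sigma_n(v_n(M))$ is a singleton for all large $n$, and for each $m\in X_{\min}(\mathcal F)$ the set $\{\widetilde v:v_n(m)\in\sigma_n(\widetilde v)\}$ is a singleton for all large $n$. For $n\ge 2$ put $W_{\widetilde v}(n)=\{w\in V_n:s(\widetilde e_w)=\widetilde v\}$, $W'_{\overline v}(n)=\{w\in V_n:s(\overline e_w)=\overline v\}$ and $[\overline v,\widetilde v,n]=W'_{\overline v}(n)\cap W_{\widetilde v}(n)$. For $m>n$, $u\in V_m$, $w\in V_n$ let $\widetilde f_{u,w}$ (resp. $\overline f_{u,w}$) be the entry $(F_{m-1}\cdots F_n)_{u,w}$, i.e. the number of finite paths from $w$ to $u$, diminished by $1$ if the path of edges $\widetilde e$ (resp. $\overline e$) from level $n$ to $u$ starts at $w$; for $m=n+1$ these are the entries $\widetilde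 f^{(n)}_{u,w},\overline f^{(n)}_{u,w}$ of the modified incidence matrices. The directed graph $\mathcal H_n$ ($n\ge 2$) has as vertices the nonempty $[\overline v,\widetilde v,n]$, with an edge from $[\overline v,\widetilde v,n]$ to $[\overline v',\widetilde v',n]$ if and only if $\overline v'\in\sigma_{n-1}(\widetilde v)$. It is *positively strongly connected* if for each $u\in V_{n+1}$ the subgraph induced on the vertices with $\sum_{w\in[\overline v,\widetilde v,n]}\widetilde f^{(n)}_{u,w}>0$ is strongly connected. **Statement.** Let $\mathcal F$ be a skeleton on $B$ and $\sigma$ an associated correspondence that can generate orders in $\mathcal P_B^*$, and suppose that all graphs $\mathcal H_n$, $n\ge 2$, are positively strongly connected. Suppose also that for each $M\in X_{\max}(\mathcal F)$, with $\widetilde v_n=v_n(M)$, there is an $n_0$ such that for all $n\ge n_0$ the set $\sigma_{n-1}(\widetilde v_{n-1})$ consists of a single vertex, also denoted $\sigma_{n-1}(\widetilde v_{n-1})$, and for all $m>n$ and all $u\in V_m$ $$\sum_{w\in W_{\widetilde v_{n-1}}(n)}\widetilde f_{u,w}=\sum_{w'\in W'_{\sigma_{n-1}(\widetilde v_{n-1})}(n)}\overline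 f_{u,w'}.$$ Then there is a perfect order $\omega$ on $B$ (one whose Vershik map, defined on $X_B\setminus X_{\max}(\omega)$, extends to a homeomorphism $\varphi_\omega$ of $X_B$) such that $\mathcal F_\omega=\mathcal F$ and $\varphi_\omega=\sigma$ on $X_{\max}(\mathcal F)$. -/

import Mathlib

/-- A Bratteli diagram. `V n` is the set of vertices of level `n`, and `E n` is the set of edges
from level `n` to level `n + 1`. -/
structure BratteliDiagram where
  V : ℕ → Type
  E : ℕ → Type
  fintypeV : ∀ n, Fintype (V n)
  fintypeE : ∀ n, Fintype (E n)
  src : ∀ {n : ℕ}, E n → V n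
  rng : ∀ {n : ℕ}, E n → V (n + 1)
  top : ∃ v₀ : V 0, ∀ v : V 0, v = v₀
  src_surjective : ∀ n : ℕ, Function.Surjective (src (n := n))
  rng_surjective : ∀ n : ℕ, Function.Surjective (rng (n := n))

namespace BratteliDiagram

attribute [instance] BratteliDiagram.fintypeV BratteliDiagram.fintypeE

variable {B : BratteliDiagram}

/-- Edge sets are discrete. -/
instance instTopologicalSpaceE (n : ℕ) : TopologicalSpace (B.E n) := ⊥

instance instDiscreteTopologyE (n : ℕ) : DiscreteTopology (B.E n) := ⟨rfl⟩

variable (B) in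
/-- The space `X_B` of infinite paths starting at the top vertex. -/
def PathSpace : Type :=
  {x : ∀ n : ℕ, B.E n // ∀ n : ℕ, B.rng (x n) = B.src (x (n + 1))}

/-- The topology generated by cylinder sets: the subspace topology of the product of the finite
discrete edge sets. -/
instance instTopologicalSpacePathSpace : TopologicalSpace B.PathSpace :=
  inferInstanceAs
    (TopologicalSpace {x : ∀ n : ℕ, B.E n // ∀ n : ℕ, B.rng (x n) = B.src (x (n + 1))})

namespace PathSpace

/-- The edge of the path from level `n` to level `n + 1`. -/
def edge (x : B.PathSpace) (n : ℕ) : B.E n := x.1 n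

/-- The vertex `v_n(x)` through which the path passes at level `n`. -/
def vert (x : B.PathSpace) (n : ℕ) : B.V n := B.src (x.edge n)

/-- Tail (cofinal) equivalence. -/
def TailEquiv (x y : B.PathSpace) : Prop := ∃ N : ℕ, ∀ n ≥ N, x.edge n = y.edge n

end PathSpace

/-- The vertices of level `n` through which some path of the set `X` passes. -/
def vertsOf (X : Set B.PathSpace) (n : ℕ) : Set (B.V n) := {v | ∃ x ∈ X, x.vert n = v}

variable (B) in
/-- `X_B` has no isolated points. -/
def NoIsolatedPaths : Prop := ∀ x : B.PathSpace, ¬ IsOpen ({x} : Set B.PathSpace)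

variable (B) in
/-- Every tail equivalence class is infinite. -/
def IsAperiodic : Prop := ∀ x : B.PathSpace, {y : B.PathSpace | x.TailEquiv y}.Infinite

variable (B) in
/-- An order on `B`: a strict linear order on each set `r⁻¹(v)`; edges with different ranges are
not comparable. -/
structure EdgeOrder where
  lt : ∀ {n : ℕ}, B.E n → B.E n → Prop
  rng_eq : ∀ {n : ℕ} {e f : B.E n}, lt e f → B.rng e = B.rng f
  irrefl : ∀ {n : ℕ} (e : B.E n), ¬ lt e e
  trans : ∀ {n : ℕ} {e f g : B.E n}, lt e f → lt f g → lt e g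
  total : ∀ {n : ℕ} {e f : B.E n}, B.rng e = B.rng f → lt e f ∨ e = f ∨ lt f e

namespace EdgeOrder

/-- `e` is the maximal edge in `r⁻¹(r(e))`. -/
def IsMaxEdge (ω : B.EdgeOrder) {n : ℕ} (e : B.E n) : Prop := ∀ f : B.E n, ¬ ω.lt e f

/-- `e` is the minimal edge in `r⁻¹(r(e))`. -/
def IsMinEdge (ω : B.EdgeOrder) {n : ℕ} (e : B.E n) : Prop := ∀ f : B.E n, ¬ ω.lt f e

/-- `f` is the successor of `e` in `r⁻¹(r(e))`. -/
def IsSucc (ω : B.EdgeOrder) {n : ℕ} (e f : B.E n) : Prop :=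
  ω.lt e f ∧ ∀ g : B.E n, ¬ (ω.lt e g ∧ ω.lt g f)

/-- The set `X_max(ω)`. -/
def Xmax (ω : B.EdgeOrder) : Set B.PathSpace := {x | ∀ n, ω.IsMaxEdge (x.edge n)}

/-- The set `X_min(ω)`. -/
def Xmin (ω : B.EdgeOrder) : Set B.PathSpace := {x | ∀ n, ω.IsMinEdge (x.edge n)}

/-- `y` is the image of the non-maximal path `x` under the Vershik map: the first non-maximal edge
of `x` is replaced by its successor, all edges before it by the minimal ones, and the later edges
are kept. -/
def IsVershikImage (ω : B.EdgeOrder) (x y : B.PathSpace) : Prop :=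
  ∃ k : ℕ, (∀ i < k, ω.IsMaxEdge (x.edge i)) ∧ ¬ ω.IsMaxEdge (x.edge k) ∧
    ω.IsSucc (x.edge k) (y.edge k) ∧ (∀ i < k, ω.IsMinEdge (y.edge i)) ∧
    ∀ i > k, y.edge i = x.edge i

/-- The homeomorphism `φ` of `X_B` extends the Vershik map, which is defined off `X_max(ω)`. -/
def ExtendsVershik (ω : B.EdgeOrder) (φ : B.PathSpace ≃ₜ B.PathSpace) : Prop :=
  ∀ x : B.PathSpace, x ∉ ω.Xmax → ω.IsVershikImage x (φ x)

/-- `ω` is perfect: its Vershik map extends to a homeomorphism of `X_B`. -/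
def IsPerfect (ω : B.EdgeOrder) : Prop := ∃ φ : B.PathSpace ≃ₜ B.PathSpace, ω.ExtendsVershik φ

end EdgeOrder

variable (B) in
/-- `B` is regular: for every order, the sets of maximal and of minimal paths have empty
interior. -/
def IsRegular : Prop := ∀ ω : B.EdgeOrder, interior ω.Xmax = ∅ ∧ interior ω.Xmin = ∅

variable (B) in
/-- The `n`-th incidence matrix: the entry at `(v, w)` is the number of edges from `w` to `v`. -/
noncomputable def incidence (n : ℕ) : Matrix (B.V (n + 1)) (B.V n) ℕ :=
  fun v w => Nat.card {e : B.E n // B.rng e = v ∧ B.src e = w}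

open Classical in
variable (B) in
/-- The product `F_{n+k-1} ⋯ F_n`: the entry at `(u, w)` is the number of finite paths from the
vertex `w` of level `n` to the vertex `u` of level `n + k`. -/
noncomputable def incidenceProd (n : ℕ) : ∀ k : ℕ, Matrix (B.V (n + k)) (B.V n) ℕ
  | 0 => (1 : Matrix (B.V n) (B.V n) ℕ)
  | k + 1 => B.incidence (n + k) * incidenceProd n k

variable (B) in
/-- A skeleton on the (unordered) diagram `B`. -/
structure Skeleton where
  /-- The maximal paths. -/
  Xmax : Set B.PathSpace
  /-- The minimal paths. -/
  Xmin : Set B.PathSpace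
  /-- The designated maximal edge with range `v`. -/
  maxEdge : ∀ {n : ℕ}, B.V (n + 1) → B.E n
  /-- The designated minimal edge with range `v`. -/
  minEdge : ∀ {n : ℕ}, B.V (n + 1) → B.E n
  isClosed_Xmax : IsClosed Xmax
  isClosed_Xmin : IsClosed Xmin
  isNowhereDense_Xmax : IsNowhereDense Xmax
  isNowhereDense_Xmin : IsNowhereDense Xmin
  card_eq : Nonempty (Xmax ≃ Xmin)
  /-- Maximal paths meeting at level `N` coincide up to level `N`. -/
  max_agree : ∀ M ∈ Xmax, ∀ M' ∈ Xmax, ∀ N : ℕ, M.vert N = M'.vert N →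
    ∀ n < N, M.edge n = M'.edge n
  /-- Minimal paths meeting at level `N` coincide up to level `N`. -/
  min_agree : ∀ m ∈ Xmin, ∀ m' ∈ Xmin, ∀ N : ℕ, m.vert N = m'.vert N →
    ∀ n < N, m.edge n = m'.edge n
  rng_maxEdge : ∀ {n : ℕ} (v : B.V (n + 1)), B.rng (maxEdge v) = v
  rng_minEdge : ∀ {n : ℕ} (v : B.V (n + 1)), B.rng (minEdge v) = v
  src_maxEdge : ∀ {n : ℕ} (v : B.V (n + 1)), B.src (maxEdge v) ∈ vertsOf Xmax n
  src_minEdge : ∀ {n : ℕ} (v : B.V (n + 1)), B.src (minEdge v) ∈ vertsOf Xmin n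
  /-- Vertices (of level at least `2`) that are maximal and minimal have distinct extremal
  edges. -/
  maxEdge_ne_minEdge : ∀ {n : ℕ} (v : B.V (n + 2)),
    v ∈ vertsOf Xmax (n + 2) → v ∈ vertsOf Xmin (n + 2) → maxEdge v ≠ minEdge v
  /-- One edge is not designated both maximal and minimal among several edges. -/
  maxEdge_ne_minEdge_of_ne : ∀ {n : ℕ} (e f : B.E n), B.rng e = B.rng f → e ≠ f →
    maxEdge (B.rng e) ≠ minEdge (B.rng e)
  /-- Maximal paths run along designated maximal edges. -/
  edge_of_mem_Xmax : ∀ M ∈ Xmax, ∀ n : ℕ, M.edge n = maxEdge (M.vert (n + 1))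
  /-- Minimal paths run along designated minimal edges. -/
  edge_of_mem_Xmin : ∀ m ∈ Xmin, ∀ n : ℕ, m.edge n = minEdge (m.vert (n + 1))

/-- The skeleton of the order `ω` is `F`: the same extremal paths and the same extremal edges. -/
structure EdgeOrder.HasSkeleton (ω : B.EdgeOrder) (F : B.Skeleton) : Prop where
  Xmax_eq : ω.Xmax = F.Xmax
  Xmin_eq : ω.Xmin = F.Xmin
  isMaxEdge : ∀ {n : ℕ} (v : B.V (n + 1)), ω.IsMaxEdge (F.maxEdge v)
  isMinEdge : ∀ {n : ℕ} (v : B.V (n + 1)), ω.IsMinEdge (F.minEdge v)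

namespace Skeleton

variable (F : B.Skeleton)

/-- The maximal vertices of level `n`. -/
def maxVerts (n : ℕ) : Set (B.V n) := vertsOf F.Xmax n

/-- The minimal vertices of level `n`. -/
def minVerts (n : ℕ) : Set (B.V n) := vertsOf F.Xmin n

/-- The source, at level `n`, of the path of designated maximal edges with range `u` at
level `n + k`. -/
def maxSrc (n : ℕ) : ∀ k : ℕ, B.V (n + k) → B.V n
  | 0, u => u
  | k + 1, u => maxSrc n k (B.src (F.maxEdge u))

/-- The source, at level `n`, of the path of designated minimal edges with range `u` at
level `n + k`. -/
def minSrc (n : ℕ) : ∀ k : ℕ, B.V (n + k) → B.V n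
  | 0, u => u
  | k + 1, u => minSrc n k (B.src (F.minEdge u))

open Classical in
/-- The number of finite paths from `w` (level `n`) to `u` (level `n + k`), not counting the path
of maximal edges with range `u`. For `k = 1` this is the entry of the modified incidence matrix
`F̃_n`. -/
noncomputable def modMax (n k : ℕ) (u : B.V (n + k)) (w : B.V n) : ℕ :=
  B.incidenceProd n k u w - if F.maxSrc n k u = w then 1 else 0

open Classical in
/-- The number of finite paths from `w` (level `n`) to `u` (level `n + k`), not counting the path
of minimal edges with range `u`. For `k = 1` this is the entry of the modified incidence matrix
`F̄_n`. -/
noncomputable def modMin (n k : ℕ) (u : B.V (n + k)) (w : B.V n) : ℕ :=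
  B.incidenceProd n k u w - if F.minSrc n k u = w then 1 else 0

/-- A correspondence, except for the requirement that the map on paths is a homeomorphism.
The maps `σ_n : Ṽ_n → 2^{V̄_n}` are encoded by maps on all of `V_n`, empty off `Ṽ_n`. -/
structure PreCorrespondence where
  map : ∀ n : ℕ, B.V n → Set (B.V n)
  supp : ∀ (n : ℕ) (v w : B.V n), w ∈ map n v → v ∈ F.maxVerts n ∧ w ∈ F.minVerts n
  covers : ∀ n : ℕ, ∀ w ∈ F.minVerts n, ∃ v ∈ F.maxVerts n, w ∈ map n v
  consistent : ∀ (n k : ℕ) (v w : B.V (n + k)), w ∈ map (n + k) v →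
    F.minSrc n k w ∈ map n (F.maxSrc n k v)
  existsUnique_min : ∀ M : F.Xmax, ∃! m : F.Xmin, ∀ n, m.1.vert n ∈ map n (M.1.vert n)
  existsUnique_max : ∀ m : F.Xmin, ∃! M : F.Xmax, ∀ n, m.1.vert n ∈ map n (M.1.vert n)

/-- The map `σ : X_max(F) → X_min(F)` sending `M` to the unique minimal path `m` with
`v_n(m) ∈ σ_n(v_n(M))` for all `n`. -/
noncomputable def PreCorrespondence.pathMap {F : B.Skeleton} (σ : F.PreCorrespondence) :
    F.Xmax → F.Xmin :=
  fun M => (σ.existsUnique_min M).choose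

/-- A correspondence associated to the skeleton `F`. -/
structure Correspondence extends F.PreCorrespondence where
  isHomeomorph : IsHomeomorph toPreCorrespondence.pathMap

/-- The cell `[v̄, ṽ, n + 1] = W'_{v̄}(n + 1) ∩ W_{ṽ}(n + 1)`, a set of vertices of
level `n + 1`. -/
def cell (n : ℕ) (vbar vtil : B.V n) : Set (B.V (n + 1)) :=
  {w | B.src (F.minEdge w) = vbar ∧ B.src (F.maxEdge w) = vtil}

/-- The vertices of the graph `H_{n+1}`: the pairs `(v̄, ṽ)` with nonempty cell. -/
def GraphVertex (n : ℕ) : Type := {q : B.V n × B.V n // (F.cell n q.1 q.2).Nonempty}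

open Classical in
/-- The crossing number `P_u([v̄, ṽ, n + 1])` for a vertex `u` of level `n + 2`. -/
noncomputable def crossing (n : ℕ) (u : B.V (n + 1 + 1)) (q : F.GraphVertex n) : ℕ :=
  ∑ w : B.V (n + 1) with w ∈ F.cell n q.1.1 q.1.2, F.modMax (n + 1) 1 u w

open Classical in
/-- The sum relation at level `n + 1` for a maximal vertex `ṽ` and a minimal vertex `v̄` of
level `n`, and for a vertex `u` of level `n + 1 + k`:
`∑_{w ∈ W_{ṽ}(n+1)} f̃_{u,w} = ∑_{w ∈ W'_{v̄}(n+1)} f̄_{u,w}`. -/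
def SumRelation (n : ℕ) (vtil vbar : B.V n) (k : ℕ) (u : B.V (n + 1 + k)) : Prop :=
  ∑ w : B.V (n + 1) with B.src (F.maxEdge w) = vtil, F.modMax (n + 1) k u w =
    ∑ w : B.V (n + 1) with B.src (F.minEdge w) = vbar, F.modMin (n + 1) k u w

namespace Correspondence

variable {F : B.Skeleton} (σ : F.Correspondence)

/-- The graph `H_{n+1}` associated to `(F, σ)`. -/
def graph (n : ℕ) : Digraph (F.GraphVertex n) where
  Adj q q' := q'.1.1 ∈ σ.map n q.1.2

/-- `H_{n+1}` is positively strongly connected: for each vertex `u` of level `n + 2`, the subgraph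
induced on the vertices with positive crossing number is strongly connected. -/
def PositivelyStronglyConnected (n : ℕ) : Prop :=
  ∀ (u : B.V (n + 1 + 1)) (q q' : {q : F.GraphVertex n // 0 < F.crossing n u q}),
    Relation.ReflTransGen (fun a b => (σ.graph n).Adj a.1 b.1) q q'

/-- `(F, σ)` can generate orders in `P_B^*`: along each maximal path `M` the sets `σ_n(v_n(M))`,
and along each minimal path `m` the sets `σ_n⁻¹(v_n(m))`, are eventually singletons. -/
def GeneratesPBStar : Prop :=
  (∀ M ∈ F.Xmax, ∃ n₀ : ℕ, ∀ n ≥ n₀, ∃ w, σ.map n (M.vert n) = {w}) ∧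
    ∀ m ∈ F.Xmin, ∃ n₀ : ℕ, ∀ n ≥ n₀, ∃ v, {v' | m.vert n ∈ σ.map n v'} = {v}

end Correspondence

end Skeleton

end BratteliDiagram

/-! An order with skeleton `F` amounts to enumerating, at each vertex `u`, the edges into `u` from
the designated minimal to the designated maximal one. Its Vershik map extends by `σ` once the
following holds for each `K` and all high levels: the maximal ancestor, at level `K`, of the source
of an edge and the minimal ancestor of the source of its successor correspond under `σ.map K`.
Images of paths near a maximal path `M` then run along minimal edges to the vertex of `σ M` at level
`K`, which gives continuity (`HasSkeleton.exists_extendsVershik`).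

Such an enumeration is an Eulerian trail. Each edge into `u` is an arc, whose entrance colour comes
from the minimal ancestors of its source and whose exit colour comes from the maximal ones. A trail
exists when the arcs are balanced and connected (`exists_eulerian_rank`). The sum relations at two
consecutive levels differ exactly by the balance condition (`card_edges_eq`), and positive strong
connectivity gives connectedness.

The level from which the sum relation holds depends on `M`, so the ancestors at one fixed level
cannot serve as colours. The colour is instead the first vertex of level at least `K` on the maximal
side that is linked, that is, in one-to-one correspondence with a minimal vertex and subject to the
sum relation. Compactness of `F.Xmax` bounds the levels of these vertices (`exists_linkedBetween`).
At each vertex the largest `K` whose bound lies low enough is used, and consistency of `σ` settles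
all smaller levels. -/

/-! ### Eulerian trails by way of permutations. -/

/-- Redirecting a permutation at two points of different cycles joins these cycles. -/
theorem Equiv.Perm.SameCycle.mul_swap {E : Type*} [Finite E] [DecidableEq E] {π : Equiv.Perm E}
    {a e g : E} (he : π.SameCycle a e) (hg : ¬ π.SameCycle a g) :
    (∀ x, π.SameCycle a x → (π * Equiv.swap e g).SameCycle a x) ∧
      (π * Equiv.swap e g).SameCycle a g := by
  cases nonempty_fintype E
  set ρ := π * Equiv.swap e g with hρ
  have hρe : ρ e = π g := by simp [hρ]
  have hρg : ρ g = π e := by simp [hρ]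
  have hρx : ∀ x, x ≠ e → x ≠ g → ρ x = π x := fun x h1 h2 => by
    simp [hρ, Equiv.swap_apply_of_ne_of_ne h1 h2]
  have step : ∀ x, ρ.SameCycle a x → ρ.SameCycle a (ρ x) := fun x hx =>
    Equiv.Perm.sameCycle_apply_right.2 hx
  -- From `e`, `ρ` jumps to `π g` and then follows the `π`-cycle of `g`, which avoids `e`, until it
  -- reaches `g`.
  have key : ρ.SameCycle a e → ρ.SameCycle a g := by
    intro hae
    by_contra hag
    have horb : ∀ i : ℕ, ρ.SameCycle a ((π ^ i) (π g)) := by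
      intro i
      induction i with
      | zero => simpa [← hρe] using step e hae
      | succ i ih =>
        have h1 : (π ^ i) (π g) ≠ e := by
          intro h
          apply hg
          have : π.SameCycle g e := ⟨(i + 1 : ℕ), by rw [zpow_natCast, pow_succ]; simpa using h⟩
          exact he.trans this.symm
        have h2 : (π ^ i) (π g) ≠ g := fun h => hag (h ▸ ih)
        have := step _ ih
        rw [hρx _ h1 h2] at this
        rwa [pow_succ']
    have hgg : π.SameCycle (π g) g := Equiv.Perm.sameCycle_apply_left.2 (Equiv.Perm.SameCycle.refl _ _)
    obtain ⟨i, -, -, hi⟩ := hgg.exists_pow_eq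
    exact hag (hi ▸ horb i)
  -- The `ρ`-orbit follows the `π`-orbit of `a`, except for a detour at `e` through the cycle of
  -- `g`, which comes back at `π e = ρ g`.
  have main : ∀ i : ℕ, ρ.SameCycle a ((π ^ i) a) := by
    intro i
    induction i with
    | zero => simpa using Equiv.Perm.SameCycle.refl _ _
    | succ i ih =>
      rw [pow_succ', Equiv.Perm.mul_apply]
      have h2 : (π ^ i) a ≠ g := fun h => hg ⟨(i : ℤ), by simpa using h⟩
      by_cases h1 : (π ^ i) a = e
      · rw [h1] at ih ⊢
        rw [← hρg]
        exact step _ (key ih)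
      · rw [← hρx _ h1 h2]
        exact step _ ih
  have all : ∀ x, π.SameCycle a x → ρ.SameCycle a x := by
    intro x hx
    obtain ⟨i, -, -, hi⟩ := hx.exists_pow_eq
    exact hi ▸ main i
  exact ⟨all, key (all e he)⟩

/-- A balanced and connected system of arcs, each with an entrance colour `α` and an exit
colour `β`, can be enumerated from `mn` to `mx` so that each arc enters where the preceding one
exits. -/
theorem exists_eulerian_rank {E Γ : Type*} [Finite E] (mn mx : E) (hne : mn ≠ mx)
    (α β : E → Γ)
    (hbal : ∀ c, Nat.card {e // e ≠ mx ∧ β e = c} = Nat.card {e // e ≠ mn ∧ α e = c})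
    (hconn : ∀ e e', e ≠ mx → e' ≠ mx →
      Relation.ReflTransGen (fun x y => (α y = β x ∨ β x = β y) ∧ y ≠ mx) e e') :
    ∃ f : E → ℕ, Function.Injective f ∧ (∀ e, f mn ≤ f e) ∧ (∀ e, f e ≤ f mx) ∧
      ∀ e e', f e < f e' → (∀ g, ¬ (f e < f g ∧ f g < f e')) → α e' = β e := by
  classical
  cases nonempty_fintype E
  -- The trail is closed up by sending `mx` to `mn`. Balance gives a bijection for each colour,
  -- hence a decomposition into closed trails; one whose cycle through `mn` is largest turns out to
  -- be a single cycle.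
  let P : Equiv.Perm E → Prop := fun π => π mx = mn ∧ ∀ e ≠ mx, α (π e) = β e
  have hP : ∃ π, P π := by
    have hfib : ∀ c, Nonempty
        ({x : {e // e ≠ mx} // β x = c} ≃ {x : {e // e ≠ mn} // α x = c}) := fun c => by
      refine ⟨(Equiv.subtypeSubtypeEquivSubtypeInter (fun e => e ≠ mx) (fun e => β e = c)).trans
        (Equiv.trans ?_
          (Equiv.subtypeSubtypeEquivSubtypeInter (fun e => e ≠ mn) (fun e => α e = c)).symm)⟩
      exact (Finite.card_eq.1 (hbal c)).some
    let g : {e // e ≠ mx} ≃ {e // e ≠ mn} :=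
      (Equiv.sigmaFiberEquiv (fun x : {e // e ≠ mx} => β x)).symm.trans
        ((Equiv.sigmaCongrRight fun c => (hfib c).some).trans
          (Equiv.sigmaFiberEquiv (fun x : {e // e ≠ mn} => α x)))
    have hg : ∀ x, α (g x) = β x := fun x => ((hfib (β x)).some ⟨x, rfl⟩).2
    let h : E → E := fun e => if h : e = mx then mn else g ⟨e, h⟩
    have hinj : Function.Injective h := by
      intro x y hxy
      by_cases hx : x = mx <;> by_cases hy : y = mx
      · rw [hx, hy]
      · simp only [h, hx, hy, dite_true, dite_false] at hxy
        exact absurd hxy.symm (g ⟨y, hy⟩).2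
      · simp only [h, hx, hy, dite_true, dite_false] at hxy
        exact absurd hxy (g ⟨x, hx⟩).2
      · simp only [h, hx, hy, dite_false] at hxy
        simpa using g.injective (Subtype.ext hxy)
    refine ⟨Equiv.ofBijective h (Finite.injective_iff_bijective.1 hinj), ?_, ?_⟩
    · simp [h]
    · intro e he
      simp [h, he, hg]
  obtain ⟨π₀, hπ₀⟩ := hP
  have : Nonempty {π // P π} := ⟨⟨π₀, hπ₀⟩⟩
  obtain ⟨⟨π, hπ⟩, hmax⟩ := Finite.exists_max
    (fun π : {π // P π} => Set.ncard {x | π.1.SameCycle mn x})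
  have hmx : π.SameCycle mn mx := by
    rw [← hπ.1]
    exact Equiv.Perm.sameCycle_apply_left.2 (Equiv.Perm.SameCycle.refl _ _)
  -- Exchanging the images of two arcs with the same exit colour preserves `P`, and would enlarge
  -- the cycle of `mn` if `g` lay outside it.
  have hjoin : ∀ e g, e ≠ mx → g ≠ mx → β e = β g → π.SameCycle mn e → π.SameCycle mn g := by
    intro e g he hg heg hCe
    by_contra hCg
    have hρ : P (π * Equiv.swap e g) := by
      refine ⟨?_, fun x hx => ?_⟩
      · simp [Equiv.swap_apply_of_ne_of_ne he.symm hg.symm, hπ.1]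
      · by_cases h1 : x = e
        · subst h1; simp [hπ.2 g hg, heg]
        by_cases h2 : x = g
        · subst h2; simp [hπ.2 e he, heg]
        simp [Equiv.swap_apply_of_ne_of_ne h1 h2, hπ.2 x hx]
    obtain ⟨h1, h2⟩ := hCe.mul_swap hCg
    refine absurd (hmax ⟨_, hρ⟩) (not_le.2 ?_)
    refine Set.ncard_lt_ncard ?_ (Set.toFinite _)
    exact ⟨fun x hx => h1 x hx, fun h => hCg (h h2)⟩
  have hall : ∀ x, π.SameCycle mn x := by
    intro x
    by_cases hx : x = mx
    · rw [hx]; exact hmx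
    have : ∀ y, Relation.ReflTransGen (fun x y => (α y = β x ∨ β x = β y) ∧ y ≠ mx) mn y →
        y ≠ mx ∧ π.SameCycle mn y := by
      intro y hy
      induction hy with
      | refl => exact ⟨hne, Equiv.Perm.SameCycle.refl _ _⟩
      | @tail y z _ hyz ih =>
        refine ⟨hyz.2, ?_⟩
        rcases hyz.1 with h | h
        -- The arc before `z` exits with the colour with which `z` is entered, so it has the exit
        -- colour of `y`. The exception is the artificial step from `mx` to `mn`.
        · have hz : π (π⁻¹ z) = z := by simp
          by_cases hpre : π⁻¹ z = mx
          · have : z = mn := by rw [← hz, hpre, hπ.1]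
            rw [this]
          · have h2 := hπ.2 _ hpre
            rw [hz, h] at h2
            have := hjoin y _ ih.1 hpre h2 ih.2
            rw [← hz]
            exact Equiv.Perm.sameCycle_apply_right.2 this
        · exact hjoin y z ih.1 hyz.2 h ih.2
    exact (this x (hconn mn x hne hx)).2
  have hex : ∀ x, ∃ i : ℕ, (π ^ i) mn = x := fun x => by
    obtain ⟨i, -, -, hi⟩ := (hall x).exists_pow_eq
    exact ⟨i, hi⟩
  -- The rank is the number of steps from `mn` along the single cycle.
  let f : E → ℕ := fun x => Nat.find (hex x)
  have hf : ∀ x, (π ^ f x) mn = x := fun x => Nat.find_spec (hex x)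
  have hfle : ∀ x i, (π ^ i) mn = x → f x ≤ i := fun x i hi => Nat.find_min' (hex x) hi
  have hf0 : f mn = 0 := Nat.le_zero.1 (hfle mn 0 (by simp))
  have hmxle : ∀ e, f e ≤ f mx := by
    intro e
    by_contra hlt
    push Not at hlt
    have hcyc : (π ^ (f mx + 1)) mn = mn := by
      rw [pow_succ', Equiv.Perm.mul_apply, hf, hπ.1]
    have : (π ^ (f e - (f mx + 1))) mn = e := by
      conv_rhs => rw [← hf e, show f e = (f e - (f mx + 1)) + (f mx + 1) by omega, pow_add,
        Equiv.Perm.mul_apply, hcyc]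
    have := hfle e _ this
    omega
  have hinj : Function.Injective f := fun x y hxy => by rw [← hf x, hxy, hf y]
  refine ⟨f, hinj, fun e => by rw [hf0]; exact Nat.zero_le _, hmxle, ?_⟩
  intro e e' hlt hbetween
  have he : e ≠ mx := by
    rintro rfl
    exact absurd (hmxle e') (not_le.2 hlt)
  have h1 : f (π e) ≤ f e + 1 := hfle _ _ (by rw [pow_succ', Equiv.Perm.mul_apply, hf])
  have h2 : f e < f (π e) := by
    by_contra hle
    push Not at hle
    rcases Nat.eq_zero_or_pos (f (π e)) with h0 | hpos
    · have : π e = mn := hinj (h0.trans hf0.symm)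
      exact he (π.injective (this.trans hπ.1.symm))
    · have : (π ^ (f (π e) - 1)) mn = e := by
        apply π.injective
        rw [← Equiv.Perm.mul_apply, ← pow_succ', Nat.sub_add_cancel hpos, hf]
      have := hfle _ _ this
      omega
  have h3 : f e' = f (π e) := by
    have := hbetween (π e)
    omega
  rw [hinj h3]
  exact hπ.2 e he

/-! ### Counting finite paths other than the designated ones. -/

namespace BratteliDiagram

variable {B : BratteliDiagram}

/-- The source at level `j` of the path of designated edges `ed` that ends at a vertex of
level `N`. -/
def ancestor (ed : ∀ n, B.V (n + 1) → B.E n) (j : ℕ) {N : ℕ} (h : j ≤ N) : B.V N → B.V j :=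
  Nat.leRec (motive := fun N _ => B.V N → B.V j) id (fun n _ f v => f (B.src (ed n v))) h

section Ancestor

variable (ed : ∀ n, B.V (n + 1) → B.E n)

@[simp]
theorem ancestor_self (j : ℕ) (v : B.V j) : ancestor ed j le_rfl v = v := by
  simp [ancestor, Nat.leRec_self]

theorem ancestor_succ {j N : ℕ} (h : j ≤ N) (v : B.V (N + 1)) :
    ancestor ed j (Nat.le_succ_of_le h) v = ancestor ed j h (B.src (ed N v)) := by
  simp only [ancestor]
  rw [Nat.leRec_succ]

theorem ancestor_ancestor {i j N : ℕ} (hij : i ≤ j) (hjN : j ≤ N) (v : B.V N) :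
    ancestor ed i hij (ancestor ed j hjN v) = ancestor ed i (hij.trans hjN) v := by
  induction N, hjN using Nat.le_induction with
  | base => simp
  | succ N h ih => rw [ancestor_succ ed h, ancestor_succ ed (hij.trans h), ih]

theorem ancestor_vert {x : B.PathSpace} {N : ℕ}
    (hx : ∀ n < N, x.edge n = ed n (x.vert (n + 1))) {j : ℕ} (h : j ≤ N) :
    ancestor ed j h (x.vert N) = x.vert j := by
  induction N, h using Nat.le_induction with
  | base => simp
  | succ N h ih =>
    rw [ancestor_succ ed h, ← hx N (Nat.lt_succ_self N)]
    exact ih fun n hn => hx n (hn.trans (Nat.lt_succ_self N))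

end Ancestor

section Counting

open Classical in
theorem incidenceProd_succ (n k : ℕ) (u : B.V (n + k + 1)) (x : B.V n) :
    B.incidenceProd n (k + 1) u x =
      ∑ e : B.E (n + k) with B.rng e = u, B.incidenceProd n k (B.src e) x := by
  have h1 : B.incidenceProd n (k + 1) u x =
      ∑ w, B.incidence (n + k) u w * B.incidenceProd n k w x := rfl
  rw [h1, ← Finset.sum_fiberwise (s := Finset.univ.filter fun e : B.E (n + k) => B.rng e = u)
    (g := fun e => B.src e)]
  refine Finset.sum_congr rfl fun w _ => ?_
  rw [Finset.sum_congr rfl (g := fun _ => B.incidenceProd n k w x), Finset.sum_const, smul_eq_mul]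
  · congr 1
    rw [incidence, Nat.card_eq_fintype_card, Fintype.card_subtype, Finset.filter_filter]
  · intro e he
    rw [(Finset.mem_filter.1 he).2]

variable (ed : ∀ n, B.V (n + 1) → B.E n)

open Classical in
/-- The number of finite paths from `w` to `u`, not counting the path of designated edges. -/
noncomputable def modCount (n k : ℕ) (u : B.V (n + k)) (w : B.V n) : ℕ :=
  B.incidenceProd n k u w - if ancestor ed n (Nat.le_add_right n k) u = w then 1 else 0

variable {ed}

theorem one_le_incidenceProd_ancestor (hed : ∀ n v, B.rng (ed n v) = v) (n k : ℕ)
    (u : B.V (n + k)) :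
    1 ≤ B.incidenceProd n k u (ancestor ed n (Nat.le_add_right n k) u) := by
  classical
  induction k with
  | zero =>
    rw [show ancestor ed n (Nat.le_add_right n 0) u = u from ancestor_self ed n u]
    simp [incidenceProd]
  | succ k ih =>
    rw [incidenceProd_succ]
    have h := ih (B.src (ed (n + k) u))
    rw [← ancestor_succ ed (Nat.le_add_right n k) u] at h
    exact h.trans (Finset.single_le_sum
      (f := fun e => B.incidenceProd n k (B.src e) (ancestor ed n _ u))
      (fun _ _ => Nat.zero_le _) (Finset.mem_filter.2 ⟨Finset.mem_univ _, hed _ u⟩))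

open Classical in
theorem modCount_add (hed : ∀ n v, B.rng (ed n v) = v) (n k : ℕ) (u : B.V (n + k)) (w : B.V n) :
    modCount ed n k u w + (if ancestor ed n (Nat.le_add_right n k) u = w then 1 else 0) =
      B.incidenceProd n k u w := by
  rw [modCount]
  apply Nat.sub_add_cancel
  split_ifs with h
  · rw [← h]
    exact one_le_incidenceProd_ancestor hed n k u
  · exact Nat.zero_le _

variable (ed) in
open Classical in
/-- The number of finite paths to `u` from the vertices `w` of level `j + 1` with
`s(ed w) = a`, not counting the path of designated edges. -/
noncomputable def modSum (j : ℕ) (a : B.V j) (k : ℕ) (u : B.V (j + 1 + k)) : ℕ :=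
  ∑ w : B.V (j + 1) with B.src (ed j w) = a, modCount ed (j + 1) k u w

theorem le_add_one_add (j k : ℕ) : j ≤ j + 1 + k := by omega

open Classical in
theorem modSum_add (hed : ∀ n v, B.rng (ed n v) = v) (j : ℕ) (a : B.V j) (k : ℕ)
    (u : B.V (j + 1 + k)) :
    modSum ed j a k u + (if ancestor ed j (le_add_one_add j k) u = a then 1 else 0) =
      ∑ w : B.V (j + 1) with B.src (ed j w) = a, B.incidenceProd (j + 1) k u w := by
  have h1 : ancestor ed j (le_add_one_add j k) u =
      B.src (ed j (ancestor ed (j + 1) (Nat.le_add_right _ k) u)) := by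
    rw [← ancestor_ancestor ed (Nat.le_succ j) (Nat.le_add_right _ k), ancestor_succ ed le_rfl,
      ancestor_self]
  simp_rw [← modCount_add hed, Finset.sum_add_distrib, modSum]
  congr 1
  rw [Finset.sum_ite_eq]
  simp [h1]

open Classical in
theorem modSum_zero (j : ℕ) (a : B.V j) (u : B.V (j + 1)) : modSum ed j a 0 u = 0 := by
  refine Finset.sum_eq_zero fun w _ => ?_
  rw [modCount, show ancestor ed (j + 1) (Nat.le_add_right (j + 1) 0) u = u from
    ancestor_self ed _ u]
  simp [incidenceProd, Matrix.one_apply]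

open Classical in
-- Paths are split by their last edge `e`. The count at the source of `e` omits one designated path
-- for each `e`, whereas the count at `u` omits only the one through `ed _ u`; the cardinality
-- restores the others.
theorem modSum_succ (hed : ∀ n v, B.rng (ed n v) = v) (j : ℕ) (a : B.V j) (k : ℕ)
    (u : B.V (j + 1 + k + 1)) :
    modSum ed j a (k + 1) u =
      ∑ e : B.E (j + 1 + k) with B.rng e = u, modSum ed j a k (B.src e) +
        (Finset.univ.filter fun e : B.E (j + 1 + k) => B.rng e = u ∧ e ≠ ed _ u ∧
          ancestor ed j (le_add_one_add j k) (B.src e) = a).card := by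
  have h1 := modSum_add hed j a (k + 1) u
  simp_rw [incidenceProd_succ] at h1
  rw [Finset.sum_comm] at h1
  simp_rw [← modSum_add hed, Finset.sum_add_distrib] at h1
  have h2 : ∑ e : B.E (j + 1 + k) with B.rng e = u,
      (if ancestor ed j (le_add_one_add j k) (B.src e) = a then 1 else 0) =
      (Finset.univ.filter fun e : B.E (j + 1 + k) => B.rng e = u ∧ e ≠ ed _ u ∧
          ancestor ed j (le_add_one_add j k) (B.src e) = a).card +
        if ancestor ed j (le_add_one_add j (k + 1)) u = a then 1 else 0 := by
    rw [← Finset.add_sum_erase _ _ (show ed _ u ∈ _ from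
      Finset.mem_filter.2 ⟨Finset.mem_univ _, hed _ u⟩), add_comm]
    congr 1
    · rw [← Finset.sum_filter, Finset.card_eq_sum_ones]
      refine Finset.sum_congr (Finset.ext fun e => ?_) fun _ _ => rfl
      simp only [Finset.mem_filter, Finset.mem_erase, Finset.mem_univ, true_and]
      tauto
    · rw [← ancestor_succ ed (le_add_one_add j k) u]
  rw [h2] at h1
  omega

/-- If two systems of designated edges have equal modified counts over all higher vertices, then
the numbers of remaining edges above the two base vertices agree. -/
theorem card_edges_eq {ed ed' : ∀ n, B.V (n + 1) → B.E n} (hed : ∀ n v, B.rng (ed n v) = v)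
    (hed' : ∀ n v, B.rng (ed' n v) = v) {j : ℕ} {a b : B.V j}
    (h : ∀ k ≥ 1, ∀ u, modSum ed j a k u = modSum ed' j b k u) {N : ℕ} (hN : j < N)
    (u : B.V (N + 1)) :
    Nat.card {e : B.E N // B.rng e = u ∧ e ≠ ed N u ∧ ancestor ed j hN.le (B.src e) = a} =
      Nat.card
        {e : B.E N // B.rng e = u ∧ e ≠ ed' N u ∧ ancestor ed' j hN.le (B.src e) = b} := by
  classical
  obtain ⟨k, rfl⟩ := Nat.exists_eq_add_of_le (Nat.succ_le_of_lt hN)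
  -- The hypothesis starts at `k = 1`; for `k = 0` the only path is the designated one, so both
  -- counts vanish.
  have h' : ∀ u, modSum ed j a k u = modSum ed' j b k u := by
    rcases k with _ | k
    · intro u
      rw [modSum_zero, modSum_zero]
    · exact h _ (Nat.succ_pos k)
  have h1 := h (k + 1) (Nat.succ_pos k) u
  rw [modSum_succ hed, modSum_succ hed', Finset.sum_congr rfl fun e _ => h' (B.src e)] at h1
  rw [Nat.card_eq_fintype_card, Nat.card_eq_fintype_card, Fintype.card_subtype,
    Fintype.card_subtype]
  exact Nat.add_left_cancel h1

end Counting

end BratteliDiagram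

/-! ### Topology of the path space. -/

namespace BratteliDiagram

variable {B : BratteliDiagram}

namespace PathSpace

theorem rng_edge (x : B.PathSpace) (n : ℕ) : B.rng (x.edge n) = x.vert (n + 1) := x.2 n

theorem ext_edge {x y : B.PathSpace} (h : ∀ n, x.edge n = y.edge n) : x = y :=
  Subtype.ext (funext h)

theorem continuous_edge (n : ℕ) : Continuous fun x : B.PathSpace => x.edge n :=
  (continuous_apply n).comp continuous_subtype_val

theorem isOpen_edge_preimage (n : ℕ) (s : Set (B.E n)) :
    IsOpen {x : B.PathSpace | x.edge n ∈ s} :=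
  (isOpen_discrete s).preimage (continuous_edge n)

theorem isClosed_setOf_rng_eq_src :
    IsClosed {x : ∀ n : ℕ, B.E n | ∀ n : ℕ, B.rng (x n) = B.src (x (n + 1))} := by
  rw [Set.ofPred_forall]
  refine isClosed_iInter fun n => ?_
  have hc : Continuous fun x : ∀ n : ℕ, B.E n => (x n, x (n + 1)) :=
    (continuous_apply n).prodMk (continuous_apply (n + 1))
  exact (isClosed_discrete {p : B.E n × B.E (n + 1) | B.rng p.1 = B.src p.2}).preimage hc

instance : CompactSpace B.PathSpace :=
  isCompact_iff_compactSpace.1 isClosed_setOf_rng_eq_src.isCompact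

instance : T2Space B.PathSpace :=
  inferInstanceAs
    (T2Space {x : ∀ n : ℕ, B.E n // ∀ n : ℕ, B.rng (x n) = B.src (x (n + 1))})

/-- The paths that coincide with `x` below level `N` form a neighbourhood of `x`. -/
theorem isOpen_setOf_agree (x : B.PathSpace) (N : ℕ) :
    IsOpen {y : B.PathSpace | ∀ n < N, y.edge n = x.edge n} := by
  have : {y : B.PathSpace | ∀ n < N, y.edge n = x.edge n} =
      ⋂ n ∈ Set.Iio N, {y : B.PathSpace | y.edge n ∈ ({x.edge n} : Set (B.E n))} := by
    ext y
    simp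
  rw [this]
  exact (Set.finite_Iio N).isOpen_biInter fun n _ => isOpen_edge_preimage n _

theorem exists_agree_subset {x : B.PathSpace} {U : Set B.PathSpace} (hU : IsOpen U) (hx : x ∈ U) :
    ∃ N, ∀ y : B.PathSpace, (∀ n < N, y.edge n = x.edge n) → y ∈ U := by
  obtain ⟨W, hW, rfl⟩ := isOpen_induced_iff.1 hU
  obtain ⟨I, u, hu, hsub⟩ := isOpen_pi_iff.1 hW x.1 hx
  refine ⟨I.sup id + 1, fun y hy => hsub fun n hn => ?_⟩
  have : y.edge n = x.edge n :=
    hy n (Nat.lt_succ_of_le (Finset.le_sup (f := id) hn))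
  exact (show y.1 n = x.1 n from this) ▸ (hu n hn).2

theorem continuousAt_of_agree {f : B.PathSpace → B.PathSpace} {x : B.PathSpace}
    (h : ∀ N, ∃ P, ∀ y : B.PathSpace, (∀ n < P, y.edge n = x.edge n) →
      ∀ n < N, (f y).edge n = (f x).edge n) : ContinuousAt f x := by
  intro s hs
  rw [Filter.mem_map]
  obtain ⟨U, hUs, hU, hxU⟩ := mem_nhds_iff.1 hs
  obtain ⟨N, hN⟩ := exists_agree_subset hU hxU
  obtain ⟨P, hP⟩ := h N
  exact Filter.mem_of_superset
    ((isOpen_setOf_agree x P).mem_nhds fun n _ => rfl) fun y hy => hUs (hN (f y) (hP y hy))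

/-- Two paths along designated edges up to level `N` that meet there coincide up to level `N`. -/
theorem edge_eq_of_vert_eq {ed : ∀ n, B.V (n + 1) → B.E n} {x y : B.PathSpace} {N : ℕ}
    (hx : ∀ n < N, x.edge n = ed n (x.vert (n + 1)))
    (hy : ∀ n < N, y.edge n = ed n (y.vert (n + 1))) (h : x.vert N = y.vert N) :
    ∀ n < N, x.edge n = y.edge n := by
  intro n hn
  rw [hx n hn, hy n hn]
  congr 1
  rw [← ancestor_vert ed hx (Nat.succ_le_of_lt hn), ← ancestor_vert ed hy (Nat.succ_le_of_lt hn), h]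

end PathSpace

/-! ### Ancestors along the edges of a skeleton. -/

namespace Skeleton

variable (F : B.Skeleton)

/-- The source at level `j` of the path of maximal edges ending at a vertex of level `N`. -/
abbrev maxAncestor (j : ℕ) {N : ℕ} (h : j ≤ N) : B.V N → B.V j :=
  ancestor (fun _ v => F.maxEdge v) j h

/-- The source at level `j` of the path of minimal edges ending at a vertex of level `N`. -/
abbrev minAncestor (j : ℕ) {N : ℕ} (h : j ≤ N) : B.V N → B.V j :=
  ancestor (fun _ v => F.minEdge v) j h

theorem maxAncestor_succ {j N : ℕ} (h : j ≤ N) (v : B.V (N + 1)) :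
    F.maxAncestor j (Nat.le_succ_of_le h) v = F.maxAncestor j h (B.src (F.maxEdge v)) :=
  ancestor_succ _ h v

theorem minAncestor_succ {j N : ℕ} (h : j ≤ N) (v : B.V (N + 1)) :
    F.minAncestor j (Nat.le_succ_of_le h) v = F.minAncestor j h (B.src (F.minEdge v)) :=
  ancestor_succ _ h v

theorem maxAncestor_maxAncestor {i j N : ℕ} (hij : i ≤ j) (hjN : j ≤ N) (v : B.V N) :
    F.maxAncestor i hij (F.maxAncestor j hjN v) = F.maxAncestor i (hij.trans hjN) v :=
  ancestor_ancestor _ hij hjN v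

theorem minAncestor_minAncestor {i j N : ℕ} (hij : i ≤ j) (hjN : j ≤ N) (v : B.V N) :
    F.minAncestor i hij (F.minAncestor j hjN v) = F.minAncestor i (hij.trans hjN) v :=
  ancestor_ancestor _ hij hjN v

theorem maxSrc_eq (n k : ℕ) (u : B.V (n + k)) :
    F.maxSrc n k u = F.maxAncestor n (Nat.le_add_right n k) u := by
  induction k with
  | zero => exact (ancestor_self _ n u).symm
  | succ k ih => exact (ih _).trans (F.maxAncestor_succ (Nat.le_add_right n k) u).symm

theorem minSrc_eq (n k : ℕ) (u : B.V (n + k)) :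
    F.minSrc n k u = F.minAncestor n (Nat.le_add_right n k) u := by
  induction k with
  | zero => exact (ancestor_self _ n u).symm
  | succ k ih => exact (ih _).trans (F.minAncestor_succ (Nat.le_add_right n k) u).symm

theorem modMax_eq (n k : ℕ) (u : B.V (n + k)) (w : B.V n) :
    F.modMax n k u w = modCount (fun _ v => F.maxEdge v) n k u w := by
  rw [modMax, modCount, maxSrc_eq]

theorem modMin_eq (n k : ℕ) (u : B.V (n + k)) (w : B.V n) :
    F.modMin n k u w = modCount (fun _ v => F.minEdge v) n k u w := by
  rw [modMin, modCount, minSrc_eq]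

theorem sumRelation_iff (n : ℕ) (a b : B.V n) (k : ℕ) (u : B.V (n + 1 + k)) :
    F.SumRelation n a b k u ↔
      modSum (fun _ v => F.maxEdge v) n a k u = modSum (fun _ v => F.minEdge v) n b k u := by
  simp only [SumRelation, modSum, modMax_eq, modMin_eq]

theorem maxAncestor_vert {M : B.PathSpace} (hM : M ∈ F.Xmax) {j N : ℕ} (h : j ≤ N) :
    F.maxAncestor j h (M.vert N) = M.vert j :=
  ancestor_vert _ (fun n _ => F.edge_of_mem_Xmax M hM n) h

theorem minAncestor_vert {m : B.PathSpace} (hm : m ∈ F.Xmin) {j N : ℕ} (h : j ≤ N) :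
    F.minAncestor j h (m.vert N) = m.vert j :=
  ancestor_vert _ (fun n _ => F.edge_of_mem_Xmin m hm n) h

/-- The inequality is strict because `w` itself need not be a maximal vertex, while the source of
its designated edge always is. -/
theorem exists_mem_Xmax {n N : ℕ} (h : n < N) (w : B.V N) :
    ∃ M ∈ F.Xmax, ∀ j, ∀ hj : j ≤ n, F.maxAncestor j (hj.trans h.le) w = M.vert j := by
  obtain ⟨k, rfl⟩ := Nat.exists_eq_add_of_le' (Nat.succ_le_of_lt h)
  obtain ⟨M, hM, hv⟩ := F.src_maxEdge (n := k + n) w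
  refine ⟨M, hM, fun j hj => ?_⟩
  have h' : j ≤ k + n := hj.trans (Nat.le_add_left n k)
  rw [← F.maxAncestor_vert hM h', hv]
  exact F.maxAncestor_succ h' w

theorem exists_mem_Xmin {n N : ℕ} (h : n < N) (w : B.V N) :
    ∃ m ∈ F.Xmin, ∀ j, ∀ hj : j ≤ n, F.minAncestor j (hj.trans h.le) w = m.vert j := by
  obtain ⟨k, rfl⟩ := Nat.exists_eq_add_of_le' (Nat.succ_le_of_lt h)
  obtain ⟨m, hm, hv⟩ := F.src_minEdge (n := k + n) w
  refine ⟨m, hm, fun j hj => ?_⟩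
  have h' : j ≤ k + n := hj.trans (Nat.le_add_left n k)
  rw [← F.minAncestor_vert hm h', hv]
  exact F.minAncestor_succ h' w

variable {F}

/-! ### Linked vertices and the colours they define. -/

namespace PreCorrespondence

variable (σ : F.PreCorrespondence)

theorem mem_map_ancestor {j N : ℕ} (h : j ≤ N) {v w : B.V N} (hvw : w ∈ σ.map N v) :
    F.minAncestor j h w ∈ σ.map j (F.maxAncestor j h v) := by
  obtain ⟨k, rfl⟩ := Nat.exists_eq_add_of_le h
  have := σ.consistent j k v w hvw
  rwa [F.minSrc_eq, F.maxSrc_eq] at this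

theorem vert_pathMap_mem (M : F.Xmax) (n : ℕ) :
    (σ.pathMap M).1.vert n ∈ σ.map n (M.1.vert n) :=
  (σ.existsUnique_min M).choose_spec.1 n

theorem bijective_pathMap : Function.Bijective σ.pathMap := by
  refine ⟨fun M M' h => ?_, fun m => ?_⟩
  · refine (σ.existsUnique_max (σ.pathMap M)).unique (σ.vert_pathMap_mem M) ?_
    rw [h]
    exact σ.vert_pathMap_mem M'
  · obtain ⟨M, hM, -⟩ := σ.existsUnique_max m
    exact ⟨M, (σ.existsUnique_min M).unique (σ.vert_pathMap_mem M) hM⟩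

/-- The maximal vertex `a` and the minimal vertex `b` correspond to each other only, and the sum
relation holds for them over all higher vertices. -/
structure Linked (j : ℕ) (a b : B.V j) : Prop where
  map_eq : σ.map j a = {b}
  comap_eq : {v | b ∈ σ.map j v} = {a}
  sumRelation : ∀ k ≥ 1, ∀ u : B.V (j + 1 + k), F.SumRelation j a b k u

variable {σ}

theorem Linked.mem {j : ℕ} {a b : B.V j} (h : σ.Linked j a b) : b ∈ σ.map j a := by
  rw [h.map_eq]; rfl

theorem Linked.eq_right {j : ℕ} {a b c : B.V j} (h : σ.Linked j a b) (hc : c ∈ σ.map j a) :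
    c = b := by
  rw [h.map_eq] at hc; exact hc

theorem Linked.eq_left {j : ℕ} {a b c : B.V j} (h : σ.Linked j a b) (hc : b ∈ σ.map j c) :
    c = a := by
  have : c ∈ {v | b ∈ σ.map j v} := hc
  rw [h.comap_eq] at this; exact this

variable (σ) in
/-- The pair `(a, b)` is linked, and no ancestors between the levels `K` and `j` are. -/
structure FirstLinked (K j : ℕ) (a b : B.V j) : Prop where
  le : K ≤ j
  linked : σ.Linked j a b
  not_linked : ∀ i, ∀ hi : i < j, K ≤ i → ∀ b', ¬ σ.Linked i (F.maxAncestor i hi.le a) b'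

variable (σ) in
/-- Each maximal path passes through a linked vertex between the levels `K` and `L`. -/
def LinkedBetween (K L : ℕ) : Prop :=
  ∀ M ∈ F.Xmax, ∃ j, K ≤ j ∧ j ≤ L ∧ ∃ b, σ.Linked j (M.vert j) b

/-- Compactness makes the bound independent of the path: meeting a linked vertex between `K` and `L`
is an open condition that grows with `L`. -/
theorem exists_linkedBetween
    (h : ∀ M ∈ F.Xmax, ∃ n₀ : ℕ, ∀ n ≥ n₀, ∃ b, σ.Linked n (M.vert n) b) (K : ℕ) :
    ∃ L, σ.LinkedBetween K L := by
  let U : ℕ → Set B.PathSpace := fun L =>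
    {x | ∃ j, K ≤ j ∧ j ≤ L ∧ ∃ b, σ.Linked j (x.vert j) b}
  have hU : ∀ L, IsOpen (U L) := by
    intro L
    have : U L = ⋃ j ∈ Set.Icc K L,
        {x : B.PathSpace | x.edge j ∈ {e | ∃ b, σ.Linked j (B.src e) b}} := by
      ext x
      simp only [U, Set.mem_iUnion, Set.mem_ofPred_eq, Set.mem_Icc, PathSpace.vert]
      constructor
      · rintro ⟨j, h1, h2, h3⟩; exact ⟨j, ⟨h1, h2⟩, h3⟩
      · rintro ⟨j, ⟨h1, h2⟩, h3⟩; exact ⟨j, h1, h2, h3⟩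
    rw [this]
    exact isOpen_biUnion fun j _ => PathSpace.isOpen_edge_preimage j _
  obtain ⟨L, hL⟩ := F.isClosed_Xmax.isCompact.elim_directed_cover U hU
    (fun M hM => by
      obtain ⟨n₀, hn₀⟩ := h M hM
      exact Set.mem_iUnion.2 ⟨max n₀ K, max n₀ K, le_max_right _ _, le_rfl,
        hn₀ _ (le_max_left _ _)⟩)
    (Monotone.directed_le fun L L' hLL' x ⟨j, h1, h2, h3⟩ => ⟨j, h1, h2.trans hLL', h3⟩)
  exact ⟨L, hL⟩

section Colours

variable {K L : ℕ}

theorem LinkedBetween.exists_firstLinked (hKL : σ.LinkedBetween K L) {M : B.PathSpace}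
    (hM : M ∈ F.Xmax) : ∃ j, j ≤ L ∧ ∃ b, σ.FirstLinked K j (M.vert j) b := by
  classical
  have hex : ∃ j, K ≤ j ∧ j ≤ L ∧ ∃ b, σ.Linked j (M.vert j) b := hKL M hM
  obtain ⟨h1, h2, b, hb⟩ := Nat.find_spec hex
  refine ⟨Nat.find hex, h2, b, h1, hb, fun i hi hKi b' hb' => ?_⟩
  rw [F.maxAncestor_vert hM hi.le] at hb'
  exact Nat.find_min hex hi ⟨hKi, hi.le.trans h2, b', hb'⟩

/-- The block of maximal vertices to which the maximal ancestors of `w` belong. -/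
def IsExit (σ : F.PreCorrespondence) (K : ℕ) {N : ℕ} (w : B.V N) (c : Σ j, B.V j) : Prop :=
  ∃ hj : c.1 < N, ∃ b, σ.FirstLinked K c.1 c.2 b ∧ F.maxAncestor c.1 hj.le w = c.2

/-- The block of maximal vertices that corresponds to the minimal ancestors of `w`. -/
def IsEntrance (σ : F.PreCorrespondence) (K : ℕ) {N : ℕ} (w : B.V N) (c : Σ j, B.V j) : Prop :=
  ∃ hj : c.1 < N, ∃ b, σ.FirstLinked K c.1 c.2 b ∧ F.minAncestor c.1 hj.le w = b

theorem LinkedBetween.exists_isExit (hKL : σ.LinkedBetween K L) {N : ℕ} (hL : L < N)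
    (w : B.V N) : ∃ c, σ.IsExit K w c := by
  obtain ⟨M, hM, hw⟩ := F.exists_mem_Xmax hL w
  obtain ⟨j, hj, b, hb⟩ := hKL.exists_firstLinked hM
  exact ⟨⟨j, M.vert j⟩, hj.trans_lt hL, b, hb, hw j hj⟩

/-- The minimal path through the ancestors is the image of a maximal path `M`, and it passes through
the partner of the first linked vertex of `M`. -/
theorem LinkedBetween.exists_isEntrance (hKL : σ.LinkedBetween K L) {N : ℕ} (hL : L < N)
    (w : B.V N) : ∃ c, σ.IsEntrance K w c := by
  obtain ⟨m, hm, hw⟩ := F.exists_mem_Xmin hL w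
  obtain ⟨⟨M, hM⟩, hMm⟩ := σ.bijective_pathMap.2 ⟨m, hm⟩
  obtain ⟨j, hj, b, hb⟩ := hKL.exists_firstLinked hM
  refine ⟨⟨j, M.vert j⟩, hj.trans_lt hL, b, hb, (hw j hj).trans (hb.linked.eq_right ?_)⟩
  have := σ.vert_pathMap_mem ⟨M, hM⟩ j
  rwa [hMm] at this

theorem IsExit.unique {N : ℕ} {w : B.V N} {c d : Σ j, B.V j} (hc : σ.IsExit K w c)
    (hd : σ.IsExit K w d) : c = d := by
  obtain ⟨i, a⟩ := c
  obtain ⟨j, a'⟩ := d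
  obtain ⟨(hi : i < N), b, hb, (hw : F.maxAncestor i hi.le w = a)⟩ := hc
  obtain ⟨(hj : j < N), b', hb', (hw' : F.maxAncestor j hj.le w = a')⟩ := hd
  dsimp only at *
  subst hw hw'
  rcases lt_trichotomy i j with h | rfl | h
  · have := hb'.not_linked i h hb.le b
    rw [F.maxAncestor_maxAncestor] at this
    exact absurd hb.linked this
  · rfl
  · have := hb.not_linked j h hb'.le b'
    rw [F.maxAncestor_maxAncestor] at this
    exact absurd hb'.linked this

theorem IsEntrance.unique {N : ℕ} {w : B.V N} {c d : Σ j, B.V j} (hc : σ.IsEntrance K w c)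
    (hd : σ.IsEntrance K w d) : c = d := by
  -- Being first is defined on the maximal side. Consistency moves the lower minimal ancestor there,
  -- and one-to-one linking identifies it with an ancestor of `a'` that is already linked.
  have key : ∀ i j (hij : i < j) (hj : j < N) (a : B.V i) (a' : B.V j),
      σ.FirstLinked K i a (F.minAncestor i (hij.trans hj).le w) →
      ¬ σ.FirstLinked K j a' (F.minAncestor j hj.le w) := by
    intro i j hij hj a a' h h'
    have h1 := σ.mem_map_ancestor hij.le h'.linked.mem
    rw [F.minAncestor_minAncestor] at h1
    have h2 := h.linked.eq_left h1
    exact h'.not_linked i hij h.le _ (h2 ▸ h.linked)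
  obtain ⟨i, a⟩ := c
  obtain ⟨j, a'⟩ := d
  obtain ⟨(hi : i < N), b, hb, (hw : F.minAncestor i hi.le w = b)⟩ := hc
  obtain ⟨(hj : j < N), b', hb', (hw' : F.minAncestor j hj.le w = b')⟩ := hd
  dsimp only at *
  subst hw hw'
  rcases lt_trichotomy i j with h | rfl | h
  · exact absurd hb' (key i j h hj a a' hb)
  · rw [hb'.linked.eq_left hb.linked.mem]
  · exact absurd hb (key j i h hi a' a hb')

/-- A path leaving `w` and entering `w'` along corresponding vertices stays in the same block. -/
theorem IsExit.isEntrance {N : ℕ} {w w' : B.V (N + 1)} {c : Σ j, B.V j} (hc : σ.IsExit K w c)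
    (h : B.src (F.minEdge w') ∈ σ.map N (B.src (F.maxEdge w))) : σ.IsEntrance K w' c := by
  obtain ⟨hj, b, hb, hw⟩ := hc
  have hj' := Nat.le_of_lt_succ hj
  refine ⟨hj, b, hb, hb.linked.eq_right ?_⟩
  have := σ.mem_map_ancestor hj' h
  rw [← F.maxAncestor_succ, ← F.minAncestor_succ, hw] at this
  exact this

/-- A common colour has level at least `K`, so consistency of `σ` brings the correspondence down to
every level `i ≤ K`. -/
theorem IsExit.mem_map {N : ℕ} {w w' : B.V N} {c : Σ j, B.V j} (hc : σ.IsExit K w c)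
    (hc' : σ.IsEntrance K w' c) {i : ℕ} (hi : i ≤ K) (hiN : i ≤ N) :
    F.minAncestor i hiN w' ∈ σ.map i (F.maxAncestor i hiN w) := by
  obtain ⟨hj, b, hb, hw⟩ := hc
  obtain ⟨_, b', hb', hw'⟩ := hc'
  have h1 : F.minAncestor c.1 hj.le w' ∈ σ.map c.1 (F.maxAncestor c.1 hj.le w) := by
    rw [hw, hw']
    exact hb'.linked.mem
  have h2 := σ.mem_map_ancestor (hi.trans hb.le) h1
  rwa [F.minAncestor_minAncestor, F.maxAncestor_maxAncestor] at h2

/-- This is the balance of the colour `c`. For a first linked vertex below level `N` both conditions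
only fix an ancestor at level `c.1`, so the sum relation applies; otherwise no edge has the colour.
-/
theorem card_isExit_eq (c : Σ j, B.V j) {N : ℕ} (u : B.V (N + 1)) :
    Nat.card {e : B.E N // B.rng e = u ∧ e ≠ F.maxEdge u ∧ σ.IsExit K (B.src e) c} =
      Nat.card {e : B.E N // B.rng e = u ∧ e ≠ F.minEdge u ∧ σ.IsEntrance K (B.src e) c} := by
  by_cases h : c.1 < N ∧ ∃ b, σ.FirstLinked K c.1 c.2 b
  · obtain ⟨hj, b, hb⟩ := h
    have h1 : ∀ w : B.V N, σ.IsExit K w c ↔ F.maxAncestor c.1 hj.le w = c.2 := fun w =>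
      ⟨fun ⟨_, _, _, h⟩ => h, fun h => ⟨hj, b, hb, h⟩⟩
    have h2 : ∀ w : B.V N, σ.IsEntrance K w c ↔ F.minAncestor c.1 hj.le w = b := fun w =>
      ⟨fun ⟨_, _, hb', h⟩ => h.trans (hb.linked.eq_right hb'.linked.mem),
        fun h => ⟨hj, b, hb, h⟩⟩
    simp only [h1, h2]
    exact card_edges_eq (fun _ v => F.rng_maxEdge v) (fun _ v => F.rng_minEdge v)
      (fun k hk u => (F.sumRelation_iff _ _ _ _ _).1 (hb.linked.sumRelation k hk u)) hj u
  · have h1 : ∀ w : B.V N, ¬ σ.IsExit K w c := fun w ⟨hj, b, hb, _⟩ => h ⟨hj, b, hb⟩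
    have h2 : ∀ w : B.V N, ¬ σ.IsEntrance K w c := fun w ⟨hj, b, hb, _⟩ => h ⟨hj, b, hb⟩
    simp [h1, h2]

end Colours

end PreCorrespondence

end Skeleton

end BratteliDiagram

/-! ### Rankings of the edges at one vertex. -/

namespace BratteliDiagram

variable {B : BratteliDiagram}

namespace Skeleton

variable {F : B.Skeleton}

theorem maxEdge_ne_minEdge_of_edge (u : B.V (n + 1)) {e : B.E n} (he : B.rng e = u)
    (hne : e ≠ F.maxEdge u) : F.maxEdge u ≠ F.minEdge u := by
  subst he
  exact F.maxEdge_ne_minEdge_of_ne e _ (F.rng_maxEdge _).symm hne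

open Classical in
theorem modMax_pos_iff {n : ℕ} (u : B.V (n + 1)) (w : B.V n) :
    0 < F.modMax n 1 u w ↔ ∃ e : B.E n, B.rng e = u ∧ e ≠ F.maxEdge u ∧ B.src e = w := by
  have hinc : B.incidenceProd n 1 u w =
      (Finset.univ.filter fun e : B.E n => B.rng e = u ∧ B.src e = w).card := by
    have h1 : B.incidenceProd n 1 u w = _ := incidenceProd_succ n 0 u w
    rw [h1, ← Finset.filter_filter, Finset.card_filter]
    refine Finset.sum_congr rfl fun e _ => ?_
    simp only [incidenceProd, Matrix.one_apply]
  have hsplit : F.modMax n 1 u w =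
      (Finset.univ.filter fun e : B.E n => B.rng e = u ∧ e ≠ F.maxEdge u ∧ B.src e = w).card := by
    have hsrc : F.maxSrc n 1 u = B.src (F.maxEdge u) := rfl
    rw [modMax, hinc, hsrc]
    have herase : (Finset.univ.filter fun e : B.E n =>
        B.rng e = u ∧ e ≠ F.maxEdge u ∧ B.src e = w) =
        (Finset.univ.filter fun e : B.E n => B.rng e = u ∧ B.src e = w).erase (F.maxEdge u) := by
      ext e
      simp only [Finset.mem_filter, Finset.mem_univ, true_and, Finset.mem_erase]
      tauto
    rw [herase]
    split_ifs with h
    · rw [Finset.card_erase_of_mem]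
      exact Finset.mem_filter.2 ⟨Finset.mem_univ _, F.rng_maxEdge u, h⟩
    · rw [Finset.erase_eq_of_notMem, Nat.sub_zero]
      exact fun hm => h (Finset.mem_filter.1 hm).2.2
  rw [hsplit, Finset.card_pos]
  simp only [Finset.Nonempty, Finset.mem_filter, Finset.mem_univ, true_and]

theorem crossing_pos_iff {n : ℕ} (u : B.V (n + 1 + 1)) (q : F.GraphVertex n) :
    0 < F.crossing n u q ↔ ∃ e : B.E (n + 1), B.rng e = u ∧ e ≠ F.maxEdge u ∧
      B.src e ∈ F.cell n q.1.1 q.1.2 := by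
  classical
  rw [crossing, Finset.sum_pos_iff]
  simp only [Finset.mem_filter, Finset.mem_univ, true_and]
  constructor
  · rintro ⟨w, hw, hpos⟩
    obtain ⟨e, h1, h2, rfl⟩ := (modMax_pos_iff u w).1 hpos
    exact ⟨e, h1, h2, hw⟩
  · rintro ⟨e, h1, h2, h3⟩
    exact ⟨_, h3, (modMax_pos_iff u _).2 ⟨e, h1, h2, rfl⟩⟩

/-- The ranks `f` enumerate the edges with range `u` from the minimal to the maximal one. -/
structure IsRanking (F : B.Skeleton) {N : ℕ} (u : B.V (N + 1))
    (f : {e : B.E N // B.rng e = u} → ℕ) : Prop where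
  injective : Function.Injective f
  min_le : ∀ e, f ⟨F.minEdge u, F.rng_minEdge u⟩ ≤ f e
  le_max : ∀ e, f e ≤ f ⟨F.maxEdge u, F.rng_maxEdge u⟩

theorem exists_isRanking_of_colours {N : ℕ} {Γ : Type*} (u : B.V (N + 1)) (α β : B.V N → Γ)
    (hbal : ∀ c, Nat.card {e : B.E N // B.rng e = u ∧ e ≠ F.maxEdge u ∧ β (B.src e) = c} =
      Nat.card {e : B.E N // B.rng e = u ∧ e ≠ F.minEdge u ∧ α (B.src e) = c})
    (hconn : ∀ e e' : {e : B.E N // B.rng e = u ∧ e ≠ F.maxEdge u},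
      Relation.ReflTransGen (fun x y : {e : B.E N // B.rng e = u ∧ e ≠ F.maxEdge u} =>
        α (B.src y.1) = β (B.src x.1) ∨ β (B.src x.1) = β (B.src y.1)) e e') :
    ∃ f, F.IsRanking u f ∧ ∀ e e', f e < f e' → (∀ g, ¬ (f e < f g ∧ f g < f e')) →
      α (B.src e'.1) = β (B.src e.1) := by
  -- Equality of the extremal edges forces `u` to have a single incoming edge; the Eulerian lemma
  -- needs them distinct.
  by_cases hne : F.maxEdge u = F.minEdge u
  · have hall : ∀ e : {e : B.E N // B.rng e = u}, e.1 = F.maxEdge u := fun e => by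
      by_contra h
      exact maxEdge_ne_minEdge_of_edge u e.2 h hne
    refine ⟨fun _ => 0, ⟨fun e e' _ => Subtype.ext ((hall e).trans (hall e').symm),
      fun _ => le_rfl, fun _ => le_rfl⟩, fun e e' h => absurd h (lt_irrefl _)⟩
  · let mn : {e : B.E N // B.rng e = u} := ⟨F.minEdge u, F.rng_minEdge u⟩
    let mx : {e : B.E N // B.rng e = u} := ⟨F.maxEdge u, F.rng_maxEdge u⟩
    have hcard : ∀ (γ : B.V N → Γ) (c : Γ) (m : {e : B.E N // B.rng e = u}),
        Nat.card {e : {e : B.E N // B.rng e = u} // e ≠ m ∧ γ (B.src e.1) = c} =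
          Nat.card {e : B.E N // B.rng e = u ∧ e ≠ m.1 ∧ γ (B.src e) = c} := by
      intro γ c m
      refine Nat.card_congr (Equiv.trans (Equiv.subtypeEquivRight fun e => ?_)
        (Equiv.subtypeSubtypeEquivSubtypeInter (fun e : B.E N => B.rng e = u)
          fun e => e ≠ m.1 ∧ γ (B.src e) = c))
      rw [Ne, Subtype.ext_iff]
    obtain ⟨f, h1, h2, h3, h4⟩ := exists_eulerian_rank mn mx
      (fun h => hne (congrArg Subtype.val h).symm) (fun e => α (B.src e.1))
      (fun e => β (B.src e.1))
      (fun c => by rw [hcard β c mx, hcard α c mn]; exact hbal c)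
      (fun e e' he he' => by
        have h := hconn ⟨e.1, e.2, fun h => he (Subtype.ext h)⟩
          ⟨e'.1, e'.2, fun h => he' (Subtype.ext h)⟩
        exact Relation.ReflTransGen.lift
          (p := fun x y : {e : B.E N // B.rng e = u} => (α (B.src y.1) = β (B.src x.1) ∨
            β (B.src x.1) = β (B.src y.1)) ∧ y ≠ mx) (fun x : {e : B.E N // B.rng e = u ∧ e ≠ F.maxEdge u} => ⟨x.1, x.2.1⟩)
          (fun x y hxy => ⟨hxy, fun h => y.2.2 (congrArg Subtype.val h)⟩) _ _ h)
    exact ⟨f, ⟨h1, h2, h3⟩, h4⟩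

/-- This serves the low levels, where no compatibility is required. With one colour, balance holds
because each side omits exactly one edge. -/
theorem exists_isRanking (F : B.Skeleton) {N : ℕ} (u : B.V (N + 1)) : ∃ f, F.IsRanking u f := by
  classical
  obtain ⟨f, hf, -⟩ := exists_isRanking_of_colours (F := F) u (fun _ => ()) (fun _ => ())
    (fun c => by
      have key : ∀ m : B.E N, B.rng m = u →
          Nat.card {e : B.E N // B.rng e = u ∧ e ≠ m ∧ () = c} =
            (Finset.univ.filter fun e : B.E N => B.rng e = u).card - 1 := by
        intro m hm
        rw [← Finset.card_erase_of_mem (Finset.mem_filter.2 ⟨Finset.mem_univ m, hm⟩),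
          Nat.card_eq_fintype_card, Fintype.card_subtype]
        congr 1
        ext e
        simp [and_comm]
      rw [key _ (F.rng_maxEdge u), key _ (F.rng_minEdge u)])
    (fun e e' => Relation.ReflTransGen.single (Or.inl rfl))
  exact ⟨f, hf⟩

namespace Correspondence

variable {σ : F.Correspondence}

/-- Since `L < n + 1`, the colours are read off from ancestors at levels up to `n`, so they depend
only on the cell of a vertex. Paths in the graph therefore lift to chains of edges with matching
colours. -/
theorem exists_isRanking_of_linkedBetween {K L n : ℕ} (hKL : σ.LinkedBetween K L) (hL : L < n + 1)
    (hconn : σ.PositivelyStronglyConnected n) (u : B.V (n + 1 + 1)) :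
    ∃ f, F.IsRanking u f ∧ ∀ e e', f e < f e' → (∀ g, ¬ (f e < f g ∧ f g < f e')) →
      ∀ i ≤ K, ∀ hi : i ≤ n + 1, F.minAncestor i hi (B.src e'.1) ∈
        σ.map i (F.maxAncestor i hi (B.src e.1)) := by
  choose β hβ using hKL.exists_isExit hL
  choose α hα using hKL.exists_isEntrance hL
  have hβ' : ∀ w c, β w = c ↔ σ.IsExit K w c := fun w c =>
    ⟨fun h => h ▸ hβ w, fun h => (hβ w).unique h⟩
  have hα' : ∀ w c, α w = c ↔ σ.IsEntrance K w c := fun w c =>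
    ⟨fun h => h ▸ hα w, fun h => (hα w).unique h⟩
  obtain ⟨f, hf, hcons⟩ := exists_isRanking_of_colours (F := F) u α β
    (fun c => by
      simp only [hβ', hα']
      exact PreCorrespondence.card_isExit_eq c u)
    (fun e e' => by
      let cellOf : {e : B.E (n + 1) // B.rng e = u ∧ e ≠ F.maxEdge u} →
          {q : F.GraphVertex n // 0 < F.crossing n u q} := fun e =>
        ⟨⟨(B.src (F.minEdge (B.src e.1)), B.src (F.maxEdge (B.src e.1))), B.src e.1, rfl, rfl⟩,
          (crossing_pos_iff u _).2 ⟨e.1, e.2.1, e.2.2, rfl, rfl⟩⟩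
      -- Positive crossing number means that the cell contains the source of a non-maximal edge, so
      -- every vertex on a path in the graph can be lifted.
      have hsurj : ∀ q, ∃ e, cellOf e = q := fun q => by
        obtain ⟨e, h1, h2, h3, h4⟩ := (crossing_pos_iff u q.1).1 q.2
        exact ⟨⟨e, h1, h2⟩, Subtype.ext (Subtype.ext (Prod.ext h3 h4))⟩
      have hstep : ∀ w w' : B.V (n + 1),
          B.src (F.minEdge w') ∈ σ.map n (B.src (F.maxEdge w)) → α w' = β w := fun w w' h =>
        (hα' _ _).2 ((hβ w).isEntrance h)
      have hexit : ∀ w w' : B.V (n + 1),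
          B.src (F.maxEdge w) = B.src (F.maxEdge w') → β w = β w' := fun w w' h => by
        obtain ⟨hj, b, hb, hw⟩ := hβ w'
        refine (hβ' _ _).2 ⟨hj, b, hb, ?_⟩
        rw [← hw, F.maxAncestor_succ (Nat.le_of_lt_succ hj), h,
          ← F.maxAncestor_succ (Nat.le_of_lt_succ hj)]
      have main : ∀ q q', Relation.ReflTransGen (fun a b => (σ.graph n).Adj a.1 b.1) q q' →
          ∀ e, cellOf e = q → cellOf e' = q' → Relation.ReflTransGen
            (fun x y : {e : B.E (n + 1) // B.rng e = u ∧ e ≠ F.maxEdge u} =>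
              α (B.src y.1) = β (B.src x.1) ∨ β (B.src x.1) = β (B.src y.1)) e e' := by
        intro q q' h
        induction h using Relation.ReflTransGen.head_induction_on with
        | refl =>
          intro e he he'
          -- The lift may end at another edge from the cell of `e'`; the two have the same exit
          -- colour.
          refine Relation.ReflTransGen.single (Or.inr (hexit _ _ ?_))
          exact congrArg (fun q => q.1.1.2) (he.trans he'.symm)
        | @head _ q₁ hadj _ ih =>
          intro e he he'
          obtain ⟨e₁, rfl⟩ := hsurj q₁
          subst he
          exact Relation.ReflTransGen.head (Or.inl (hstep _ _ hadj)) (ih e₁ rfl he')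
      exact main _ _ (hconn u (cellOf e) (cellOf e')) e rfl rfl)
  refine ⟨f, hf, fun e e' hlt hb i hiK hi => ?_⟩
  exact (hβ _).mem_map ((hα' _ _).1 (hcons e e' hlt hb)) hiK hi

theorem exists_isRanking_consistent (ℓ : ℕ → ℕ) (hℓ : ∀ K, σ.LinkedBetween K (ℓ K))
    (hconn : ∀ n ≥ 1, σ.PositivelyStronglyConnected n) {N : ℕ} (u : B.V (N + 1)) :
    ∃ f, F.IsRanking u f ∧ (1 < N → ∀ K, ∀ hK : K ≤ N, ℓ K < N → ∀ e e', f e < f e' →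
      (∀ g, ¬ (f e < f g ∧ f g < f e')) → F.minAncestor K hK (B.src e'.1) ∈
        σ.map K (F.maxAncestor K hK (B.src e.1))) := by
  by_cases hN : 1 < N ∧ ∃ K ≤ N, ℓ K < N
  · obtain ⟨hN, K, hKN, hK⟩ := hN
    obtain ⟨n, rfl⟩ : ∃ n, N = n + 1 := ⟨N - 1, by omega⟩
    -- One ranking must serve every `K` with `ℓ K < N`; the largest such `K ≤ N` covers the smaller
    -- ones.
    have hK₀ : ℓ (Nat.findGreatest (fun K => ℓ K < n + 1) (n + 1)) < n + 1 :=
      Nat.findGreatest_spec (P := fun K => ℓ K < n + 1) hKN hK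
    obtain ⟨f, hf, hc⟩ := exists_isRanking_of_linkedBetween (hℓ _) hK₀
      (hconn n (by omega)) u
    exact ⟨f, hf, fun _ K hKN hK e e' h1 h2 =>
      hc e e' h1 h2 K (Nat.le_findGreatest hKN hK) hKN⟩
  · obtain ⟨f, hf⟩ := F.exists_isRanking u
    exact ⟨f, hf, fun h1 K h2 h3 => absurd ⟨h1, K, h2, h3⟩ hN⟩

end Correspondence

end Skeleton

end BratteliDiagram

/-! ### Vershik images and the extension of the Vershik map. -/

namespace BratteliDiagram

variable {B : BratteliDiagram}

theorem exists_path_extend_below (ed : ∀ n, B.V (n + 1) → B.E n) (hed : ∀ n v, B.rng (ed n v) = v)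
    (k : ℕ) (z : ∀ n, B.E n) (hz : ∀ n ≥ k, B.rng (z n) = B.src (z (n + 1))) :
    ∃ y : B.PathSpace, (∀ n ≥ k, y.edge n = z n) ∧
      ∀ n < k, y.edge n = ed n (y.vert (n + 1)) := by
  induction k generalizing z with
  | zero => exact ⟨⟨z, fun n => hz n (Nat.zero_le n)⟩, fun _ _ => rfl, by simp⟩
  | succ k ih =>
    have hne : ∀ n ≥ k + 1, Function.update z k (ed k (B.src (z (k + 1)))) n = z n :=
      fun n hn => Function.update_of_ne (by omega) _ _
    obtain ⟨y, hy, hy'⟩ := ih (Function.update z k (ed k (B.src (z (k + 1))))) (fun n hn => by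
      rcases Nat.eq_or_lt_of_le hn with rfl | hlt
      · rw [Function.update_self, hed, hne _ le_rfl]
      · rw [hne n hlt, hne (n + 1) (by omega)]
        exact hz n hlt)
    refine ⟨y, fun n hn => (hy n (by omega)).trans (hne n hn), fun n hn => ?_⟩
    rcases Nat.eq_or_lt_of_le (Nat.le_of_lt_succ hn) with rfl | hlt
    · rw [hy n le_rfl, Function.update_self, PathSpace.vert, hy (n + 1) (by omega),
        hne _ le_rfl]
    · exact hy' n hlt

namespace EdgeOrder

variable (ω : B.EdgeOrder)

/-- The order in which all comparisons are reversed. -/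
def reverse : B.EdgeOrder where
  lt e f := ω.lt f e
  rng_eq h := (ω.rng_eq h).symm
  irrefl := ω.irrefl
  trans h h' := ω.trans h' h
  total h := by
    rcases ω.total h with h | h | h
    · exact Or.inr (Or.inr h)
    · exact Or.inr (Or.inl h)
    · exact Or.inl h

variable {ω}

theorem IsMaxEdge.eq {n : ℕ} {e f : B.E n} (he : ω.IsMaxEdge e) (hf : ω.IsMaxEdge f)
    (h : B.rng e = B.rng f) : e = f := by
  rcases ω.total h with h | h | h
  · exact absurd h (he f)
  · exact h
  · exact absurd h (hf e)

theorem IsMinEdge.eq {n : ℕ} {e f : B.E n} (he : ω.IsMinEdge e) (hf : ω.IsMinEdge f)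
    (h : B.rng e = B.rng f) : e = f := by
  rcases ω.total h with h | h | h
  · exact absurd h (hf e)
  · exact h
  · exact absurd h (he f)

theorem exists_isSucc {n : ℕ} {e : B.E n} (he : ¬ ω.IsMaxEdge e) : ∃ f, ω.IsSucc e f := by
  have hwf : WellFounded (fun a b : B.E n => ω.lt a b) :=
    @Finite.wellFounded_of_trans_of_irrefl _ _ _ ⟨fun _ _ _ => ω.trans⟩ ⟨ω.irrefl⟩
  have hne : {f | ω.lt e f}.Nonempty := by
    by_contra h
    exact he fun f hf => h ⟨f, hf⟩
  exact ⟨hwf.min _ hne, hwf.min_mem _ hne, fun g hg => hwf.not_lt_min _ hg.1 hg.2⟩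

theorem IsSucc.unique {n : ℕ} {e f g : B.E n} (hf : ω.IsSucc e f) (hg : ω.IsSucc e g) :
    f = g := by
  rcases ω.total ((ω.rng_eq hf.1).symm.trans (ω.rng_eq hg.1)) with h | h | h
  · exact absurd ⟨hf.1, h⟩ (hg.2 f)
  · exact h
  · exact absurd ⟨hg.1, h⟩ (hf.2 g)

/-- Reversal turns existence and uniqueness of images into surjectivity and injectivity of the
Vershik map. -/
theorem IsVershikImage.reverse {x y : B.PathSpace} (h : ω.IsVershikImage x y) :
    ω.reverse.IsVershikImage y x := by
  obtain ⟨k, h1, -, h3, h4, h5⟩ := h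
  exact ⟨k, h4, fun h => h _ h3.1, ⟨h3.1, fun g hg => h3.2 g ⟨hg.2, hg.1⟩⟩, h1,
    fun i hi => (h5 i hi).symm⟩

theorem IsVershikImage.notMem_Xmin {x y : B.PathSpace} (h : ω.IsVershikImage x y) :
    y ∉ ω.Xmin := by
  obtain ⟨k, -, -, h3, -, -⟩ := h
  exact fun hy => hy k _ h3.1

theorem exists_isVershikImage {ed : ∀ n, B.V (n + 1) → B.E n} (hed : ∀ n v, B.rng (ed n v) = v)
    (hmin : ∀ n v, ω.IsMinEdge (ed n v)) {x : B.PathSpace} (hx : x ∉ ω.Xmax) :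
    ∃ y, ω.IsVershikImage x y := by
  classical
  have hex : ∃ k, ¬ ω.IsMaxEdge (x.edge k) := not_forall.1 hx
  set k := Nat.find hex with hk
  have hbelow : ∀ i < k, ω.IsMaxEdge (x.edge i) := fun i hi => not_not.1 (Nat.find_min hex hi)
  obtain ⟨g, hg⟩ := exists_isSucc (Nat.find_spec hex)
  have hne : ∀ n ≥ k + 1, Function.update x.edge k g n = x.edge n :=
    fun n hn => Function.update_of_ne (by omega) _ _
  obtain ⟨y, hy, hy'⟩ := exists_path_extend_below ed hed k (Function.update x.edge k g)
    (fun n hn => by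
      rcases Nat.eq_or_lt_of_le hn with h | h
      · subst h
        rw [Function.update_self, hne _ le_rfl, ← ω.rng_eq hg.1]
        exact x.2 k
      · rw [hne n h, hne (n + 1) (by omega)]
        exact x.2 n)
  refine ⟨y, k, hbelow, Nat.find_spec hex, ?_, fun i hi => ?_, fun i hi => ?_⟩
  · rw [hy k le_rfl, Function.update_self]
    exact hg
  · rw [hy' i hi]
    exact hmin _ _
  · rw [hy i hi.le, hne i hi]

theorem edge_eq_of_isMinEdge {x y : B.PathSpace} {N : ℕ} (hx : ∀ n < N, ω.IsMinEdge (x.edge n))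
    (hy : ∀ n < N, ω.IsMinEdge (y.edge n)) (h : x.vert N = y.vert N) :
    ∀ n < N, x.edge n = y.edge n := by
  induction N with
  | zero => simp
  | succ N ih =>
    have hN : x.edge N = y.edge N :=
      (hx N N.lt_succ_self).eq (hy N N.lt_succ_self) (by rw [x.rng_edge, y.rng_edge, h])
    intro n hn
    rcases Nat.eq_or_lt_of_le (Nat.le_of_lt_succ hn) with rfl | hlt
    · exact hN
    · exact ih (fun n hn => hx n (hn.trans N.lt_succ_self))
        (fun n hn => hy n (hn.trans N.lt_succ_self)) (congrArg B.src hN) n hlt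

/-- Vershik images are locally determined. -/
theorem IsVershikImage.agree {x x' : B.PathSpace} (h : ω.IsVershikImage x x') :
    ∃ k, ∀ (y : B.PathSpace) (P : ℕ), k < P → (∀ n < P, y.edge n = x.edge n) →
      y ∉ ω.Xmax ∧ ∀ y', ω.IsVershikImage y y' → ∀ n < P, y'.edge n = x'.edge n := by
  obtain ⟨k, h1, h2, h3, h4, h5⟩ := h
  refine ⟨k, fun y P hkP hy => ⟨fun hyM => h2 (hy k hkP ▸ hyM k), ?_⟩⟩
  rintro y' ⟨l, g1, g2, g3, g4, g5⟩
  obtain rfl : l = k := by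
    rcases lt_trichotomy l k with hlt | heq | hgt
    · exact absurd (hy l (hlt.trans hkP) ▸ h1 l hlt) g2
    · exact heq
    · exact absurd (hy k hkP ▸ g1 k hgt) h2
  have hl : y'.edge l = x'.edge l := (hy l hkP ▸ g3).unique h3
  intro n hn
  rcases lt_trichotomy n l with hlt | rfl | hgt
  · exact edge_eq_of_isMinEdge g4 h4 (congrArg B.src hl) n hlt
  · exact hl
  · rw [g5 n hgt, h5 n hgt, hy n hn]

theorem IsVershikImage.unique {x y y' : B.PathSpace} (h : ω.IsVershikImage x y)
    (h' : ω.IsVershikImage x y') : y' = y := by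
  obtain ⟨k, hk⟩ := h.agree
  refine PathSpace.ext_edge fun n => ?_
  exact (hk x (max k n + 1) (by omega) fun _ _ => rfl).2 y' h' n (by omega)

/-- Prescribing the extremal edges is enough. A path along designated edges meets, at each level, a
path of the skeleton, and agrees with it below that level; so it is a limit of such paths, and their
set is closed. -/
theorem hasSkeleton_of_extremal {F : B.Skeleton}
    (hmax : ∀ {n : ℕ} (v : B.V (n + 1)), ω.IsMaxEdge (F.maxEdge v))
    (hmin : ∀ {n : ℕ} (v : B.V (n + 1)), ω.IsMinEdge (F.minEdge v)) : ω.HasSkeleton F := by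
  refine ⟨Set.Subset.antisymm (fun x hx => ?_) fun M hM n => ?_,
    Set.Subset.antisymm (fun x hx => ?_) fun m hm n => ?_, hmax, hmin⟩
  · rw [← F.isClosed_Xmax.closure_eq, mem_closure_iff]
    intro U hU hxU
    obtain ⟨N, hN⟩ := PathSpace.exists_agree_subset hU hxU
    have hx' : ∀ n, x.edge n = F.maxEdge (x.vert (n + 1)) := fun n =>
      (hx n).eq (hmax _) (by rw [F.rng_maxEdge, x.rng_edge])
    obtain ⟨M, hM, hv⟩ := F.src_maxEdge (x.vert (N + 1))
    rw [← hx' N] at hv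
    exact ⟨M, hN M (PathSpace.edge_eq_of_vert_eq (ed := fun _ v => F.maxEdge v)
      (fun n _ => F.edge_of_mem_Xmax M hM n) (fun n _ => hx' n) hv), hM⟩
  · rw [F.edge_of_mem_Xmax M hM n]
    exact hmax _
  · rw [← F.isClosed_Xmin.closure_eq, mem_closure_iff]
    intro U hU hxU
    obtain ⟨N, hN⟩ := PathSpace.exists_agree_subset hU hxU
    have hx' : ∀ n, x.edge n = F.minEdge (x.vert (n + 1)) := fun n =>
      (hx n).eq (hmin _) (by rw [F.rng_minEdge, x.rng_edge])
    obtain ⟨m, hm, hv⟩ := F.src_minEdge (x.vert (N + 1))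
    rw [← hx' N] at hv
    exact ⟨m, hN m (PathSpace.edge_eq_of_vert_eq (ed := fun _ v => F.minEdge v)
      (fun n _ => F.edge_of_mem_Xmin m hm n) (fun n _ => hx' n) hv), hm⟩
  · rw [F.edge_of_mem_Xmin m hm n]
    exact hmin _

/-- If successive edges are eventually compatible with the correspondence at each level, then the
Vershik map extends to a homeomorphism by the correspondence. -/
theorem HasSkeleton.exists_extendsVershik {F : B.Skeleton} (hω : ω.HasSkeleton F)
    (σ : F.PreCorrespondence)
    (hsing : ∀ M ∈ F.Xmax, ∃ n₀ : ℕ, ∀ n ≥ n₀, ∃ b, σ.map n (M.vert n) = {b})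
    (hcons : ∀ K, ∃ N₀, ∀ N ≥ N₀, ∀ hK : K ≤ N, ∀ e e' : B.E N, ω.IsSucc e e' →
      F.minAncestor K hK (B.src e') ∈ σ.map K (F.maxAncestor K hK (B.src e))) :
    ∃ φ : B.PathSpace ≃ₜ B.PathSpace, ω.ExtendsVershik φ ∧
      ∀ M : F.Xmax, φ M = σ.pathMap M := by
  classical
  have hex : ∀ x, x ∉ F.Xmax → ∃ y, ω.IsVershikImage x y := fun x hx =>
    exists_isVershikImage (fun _ v => F.rng_minEdge v) (fun _ v => hω.isMinEdge v)
      (by rwa [hω.Xmax_eq])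
  have hex' : ∀ y, y ∉ F.Xmin → ∃ x, ω.reverse.IsVershikImage y x := fun y hy =>
    exists_isVershikImage (ω := ω.reverse) (fun _ v => F.rng_maxEdge v)
      (fun _ v => hω.isMaxEdge v) (fun h => hy (hω.Xmin_eq ▸ h))
  let φ : B.PathSpace → B.PathSpace := fun x =>
    if h : x ∈ F.Xmax then (σ.pathMap ⟨x, h⟩).1 else (hex x h).choose
  have hφmax : ∀ M : F.Xmax, φ M = σ.pathMap M := fun M => dif_pos M.2
  have hφ : ∀ x, x ∉ F.Xmax → ω.IsVershikImage x (φ x) := fun x hx => by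
    simp only [φ, hx, dite_false]
    exact (hex x hx).choose_spec
  have hφmem : ∀ x, φ x ∈ F.Xmin ↔ x ∈ F.Xmax := by
    intro x
    refine ⟨fun h => ?_, fun h => ?_⟩
    · by_contra hx
      exact (hφ x hx).notMem_Xmin (hω.Xmin_eq ▸ h)
    · rw [hφmax ⟨x, h⟩]
      exact (σ.pathMap _).2
  have hinj : Function.Injective φ := by
    intro x y hxy
    by_cases hx : x ∈ F.Xmax
    · have hy : y ∈ F.Xmax := by rwa [← hφmem, ← hxy, hφmem]
      rw [hφmax ⟨x, hx⟩, hφmax ⟨y, hy⟩] at hxy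
      exact congrArg Subtype.val (σ.bijective_pathMap.1 (Subtype.ext hxy))
    · have hy : y ∉ F.Xmax := by rwa [← hφmem, ← hxy, hφmem]
      have h1 := (hφ y hy).reverse
      rw [← hxy] at h1
      exact h1.unique (hφ x hx).reverse
  have hsurj : Function.Surjective φ := by
    intro y
    by_cases hy : y ∈ F.Xmin
    · obtain ⟨M, hM⟩ := σ.bijective_pathMap.2 ⟨y, hy⟩
      exact ⟨M, by rw [hφmax, hM]⟩
    · obtain ⟨x, hx⟩ := hex' y hy
      have h1 : ω.IsVershikImage x y := hx.reverse
      have hxM : x ∉ F.Xmax := fun h => hx.notMem_Xmin (hω.Xmax_eq ▸ h :)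
      exact ⟨x, h1.unique (hφ x hxM)⟩
  have hcont : Continuous φ := by
    rw [continuous_iff_continuousAt]
    intro x
    refine PathSpace.continuousAt_of_agree fun N => ?_
    by_cases hx : x ∈ F.Xmax
    · obtain ⟨n₀, hn₀⟩ := hsing x hx
      -- At this level the vertex of `x` has a single partner `b`, which pins down the vertex of the
      -- image of every nearby path.
      set K := max N n₀ with hK
      obtain ⟨b, hb⟩ := hn₀ K (le_max_right _ _)
      obtain ⟨N₀, hN₀⟩ := hcons K
      refine ⟨max N₀ K + 1, fun y hy => ?_⟩
      have hyK : y.vert K = x.vert K := congrArg B.src (hy K (by omega))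
      have hxb : (φ x).vert K = b := by
        rw [hφmax ⟨x, hx⟩]
        have := σ.vert_pathMap_mem ⟨x, hx⟩ K
        rwa [hb] at this
      have hxmin : ∀ n < K, ω.IsMinEdge ((φ x).edge n) := by
        have h := (hφmem x).2 hx
        rw [← hω.Xmin_eq] at h
        exact fun n _ => h n
      have main : (φ y).vert K = b ∧ ∀ n < K, ω.IsMinEdge ((φ y).edge n) := by
        by_cases hyM : y ∈ F.Xmax
        · constructor
          · rw [hφmax ⟨y, hyM⟩]
            have := σ.vert_pathMap_mem ⟨y, hyM⟩ K
            dsimp only at this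
            rwa [hyK, hb] at this
          · have h := (hφmem y).2 hyM
            rw [← hω.Xmin_eq] at h
            exact fun n _ => h n
        · obtain ⟨k, h1, h2, h3, h4, h5⟩ := hφ y hyM
          -- Since `y` follows the maximal path `x` this far, its first non-maximal edge lies high
          -- enough for `hcons`.
          have hk : max N₀ K + 1 ≤ k := by
            by_contra hlt
            push Not at hlt
            refine h2 (hy k hlt ▸ ?_)
            rw [← hω.Xmax_eq] at hx
            exact hx k
          have hKk : K ≤ k := by omega
          have h6 := hN₀ k (by omega) hKk _ _ h3
          have h7 : F.maxAncestor K hKk (B.src (y.edge k)) = y.vert K :=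
            ancestor_vert _ (fun n hn => (h1 n hn).eq (hω.isMaxEdge _)
              (by rw [F.rng_maxEdge, y.rng_edge])) hKk
          have h8 : F.minAncestor K hKk (B.src ((φ y).edge k)) = (φ y).vert K :=
            ancestor_vert _ (fun n hn => (h4 n hn).eq (hω.isMinEdge _)
              (by rw [F.rng_minEdge, PathSpace.rng_edge])) hKk
          rw [h7, h8, hyK, hb] at h6
          exact ⟨h6, fun n hn => h4 n (by omega)⟩
      exact fun n hn => edge_eq_of_isMinEdge main.2 hxmin (main.1.trans hxb.symm) n (by omega)
    · obtain ⟨k, hk⟩ := (hφ x hx).agree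
      refine ⟨max N (k + 1), fun y hy n hn => ?_⟩
      obtain ⟨h1, h2⟩ := hk y _ (by omega) hy
      rw [hω.Xmax_eq] at h1
      exact h2 _ (hφ y h1) n (by omega)
  refine ⟨hcont.homeoOfEquivCompactToT2 (f := Equiv.ofBijective φ ⟨hinj, hsurj⟩), fun x hx => ?_,
    hφmax⟩
  rw [hω.Xmax_eq] at hx
  exact hφ x hx

/-- The non-maximal paths are dense, so a continuous extension is unique; its values on `F.Xmax` can
thus be asserted for every extension. -/
theorem ExtendsVershik.eq {φ ψ : B.PathSpace ≃ₜ B.PathSpace} (hφ : ω.ExtendsVershik φ)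
    (hψ : ω.ExtendsVershik ψ) (h : IsNowhereDense ω.Xmax) : φ = ψ := by
  have hdense : Dense (ω.Xmaxᶜ) := by
    rw [← interior_eq_empty_iff_dense_compl]
    exact Set.subset_eq_empty (interior_mono subset_closure) h
  refine Homeomorph.ext fun x => congrFun (Continuous.ext_on hdense φ.continuous ψ.continuous
    fun y hy => (hψ y hy).unique (hφ y hy)) x

end EdgeOrder

end BratteliDiagram

/-! ### Assembling the order from the rankings. -/

namespace BratteliDiagram

variable {B : BratteliDiagram}

namespace Skeleton

variable {F : B.Skeleton}

/-- The order given by rankings of the edges at all vertices. -/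
def orderOfRanking (f : ∀ {N : ℕ} (u : B.V (N + 1)), {e : B.E N // B.rng e = u} → ℕ)
    (hf : ∀ {N : ℕ} (u : B.V (N + 1)), F.IsRanking u (f u)) : B.EdgeOrder where
  lt e e' := ∃ u, ∃ (h : B.rng e = u) (h' : B.rng e' = u), f u ⟨e, h⟩ < f u ⟨e', h'⟩
  rng_eq := fun ⟨_, h, h', _⟩ => h.trans h'.symm
  irrefl := fun e ⟨_, _, _, hlt⟩ => lt_irrefl _ hlt
  trans := by
    rintro n e e' e'' ⟨u, h, h', hlt⟩ ⟨_, rfl, h'', hlt'⟩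
    subst h'
    exact ⟨_, h, h'', hlt.trans hlt'⟩
  total := by
    intro n e e' h
    rcases lt_trichotomy (f (B.rng e') ⟨e, h⟩) (f (B.rng e') ⟨e', rfl⟩) with h1 | h1 | h1
    · exact Or.inl ⟨_, h, rfl, h1⟩
    · exact Or.inr (Or.inl (congrArg Subtype.val ((hf _).injective h1)))
    · exact Or.inr (Or.inr ⟨_, rfl, h, h1⟩)

section OrderOfRanking

variable {f : ∀ {N : ℕ} (u : B.V (N + 1)), {e : B.E N // B.rng e = u} → ℕ}
  {hf : ∀ {N : ℕ} (u : B.V (N + 1)), F.IsRanking u (f u)}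

theorem hasSkeleton_orderOfRanking : (orderOfRanking f hf).HasSkeleton F := by
  refine EdgeOrder.hasSkeleton_of_extremal ?_ ?_
  · rintro n v e ⟨u, h, h', hlt⟩
    obtain rfl : v = u := (F.rng_maxEdge v).symm.trans h
    exact absurd ((hf v).le_max ⟨e, h'⟩) (not_le.2 hlt)
  · rintro n v e ⟨u, h, h', hlt⟩
    obtain rfl : v = u := (F.rng_minEdge v).symm.trans h'
    exact absurd ((hf v).min_le ⟨e, h⟩) (not_le.2 hlt)

theorem isSucc_orderOfRanking {N : ℕ} {e e' : B.E N} (h : (orderOfRanking f hf).IsSucc e e') :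
    ∃ (u : _) (h : B.rng e = u) (h' : B.rng e' = u), f u ⟨e, h⟩ < f u ⟨e', h'⟩ ∧
      ∀ g, ¬ (f u ⟨e, h⟩ < f u g ∧ f u g < f u ⟨e', h'⟩) := by
  obtain ⟨⟨u, h1, h2, hlt⟩, hb⟩ := h
  exact ⟨u, h1, h2, hlt, fun g hg => hb g.1 ⟨⟨u, h1, g.2, hg.1⟩, ⟨u, g.2, h2, hg.2⟩⟩⟩

end OrderOfRanking

namespace Correspondence

variable {σ : F.Correspondence}

/-- The two halves of `hStar`, applied to `M` and to its image under `σ`, make the correspondence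
one-to-one at high levels; `hSum` adds the sum relation. -/
theorem exists_linked (hStar : σ.GeneratesPBStar)
    (hSum : ∀ M ∈ F.Xmax, ∃ n₀ : ℕ, ∀ n ≥ n₀, ∀ vbar ∈ σ.map n (M.vert n),
      ∀ k ≥ 1, ∀ u : B.V (n + 1 + k), F.SumRelation n (M.vert n) vbar k u)
    (M : B.PathSpace) (hM : M ∈ F.Xmax) :
    ∃ n₀ : ℕ, ∀ n ≥ n₀, ∃ b, σ.Linked n (M.vert n) b := by
  obtain ⟨n₁, h₁⟩ := hStar.1 M hM
  obtain ⟨n₂, h₂⟩ := hStar.2 _ (σ.pathMap ⟨M, hM⟩).2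
  obtain ⟨n₃, h₃⟩ := hSum M hM
  refine ⟨max n₁ (max n₂ n₃), fun n hn => ?_⟩
  have hmem := σ.vert_pathMap_mem ⟨M, hM⟩ n
  obtain ⟨b, hb⟩ := h₁ n (by omega)
  obtain ⟨a, ha⟩ := h₂ n (by omega)
  obtain rfl : (σ.pathMap ⟨M, hM⟩).1.vert n = b := by rwa [hb] at hmem
  obtain rfl : M.vert n = a := by
    have : M.vert n ∈ {v' | (σ.pathMap ⟨M, hM⟩).1.vert n ∈ σ.map n v'} := hmem
    rwa [ha] at this
  exact ⟨_, hb, ha, h₃ n (by omega) _ hmem⟩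

end Correspondence

end Skeleton

end BratteliDiagram

theorem corollary4p8 (B : BratteliDiagram)
    (hIsolated : B.NoIsolatedPaths) (hAperiodic : B.IsAperiodic) (hRegular : B.IsRegular)
    (F : B.Skeleton) (σ : F.Correspondence) (hStar : σ.GeneratesPBStar)
    (hConnected : ∀ n ≥ 1, σ.PositivelyStronglyConnected n)
    (hSum : ∀ M ∈ F.Xmax, ∃ n₀ : ℕ, ∀ n ≥ n₀, ∀ vbar ∈ σ.map n (M.vert n),
      ∀ k ≥ 1, ∀ u : B.V (n + 1 + k), F.SumRelation n (M.vert n) vbar k u) :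
    ∃ ω : B.EdgeOrder, ω.HasSkeleton F ∧ ω.IsPerfect ∧
      ∀ φ : B.PathSpace ≃ₜ B.PathSpace, ω.ExtendsVershik φ →
        ∀ M : F.Xmax, φ M = σ.pathMap M := by
  choose ℓ hℓ using BratteliDiagram.Skeleton.PreCorrespondence.exists_linkedBetween
    (BratteliDiagram.Skeleton.Correspondence.exists_linked hStar hSum)
  choose f hf hcons using fun (N : ℕ) (u : B.V (N + 1)) =>
    BratteliDiagram.Skeleton.Correspondence.exists_isRanking_consistent ℓ hℓ hConnected u
  have hω : (BratteliDiagram.Skeleton.orderOfRanking (f _) (hf _)).HasSkeleton F :=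
    BratteliDiagram.Skeleton.hasSkeleton_orderOfRanking
  obtain ⟨φ, hφ, hφM⟩ := hω.exists_extendsVershik σ.toPreCorrespondence hStar.1 (fun K => by
    -- The rankings are compatible at level `K` when `1 < N`, where the connectivity hypothesis is
    -- available, and `ℓ K < N`.
    refine ⟨max 2 (ℓ K + 1), fun N hN hK e e' hsucc => ?_⟩
    obtain ⟨u, h, h', hlt, hb⟩ := BratteliDiagram.Skeleton.isSucc_orderOfRanking hsucc
    exact hcons N u (by omega) K hK (by omega) ⟨e, h⟩ ⟨e', h'⟩ hlt hb)
  refine ⟨_, hω, ⟨φ, hφ⟩, fun ψ hψ M => ?_⟩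
  rw [hψ.eq hφ (hω.Xmax_eq ▸ F.isNowhereDense_Xmax), hφM]
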